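/- **Theorem (Local and global consistency of the multiscale CMH scan).** *Setting.* Let $\mathcal Z\subseteq\mathbb R^d$ be measurable and let $Q$ be a probability distribution of $(X,Y,Z)$ with $Q((0,1]\times(0,1]\times\mathcal Z)=1$; the data are $n$ iid draws $(X_i,Y_i,Z_i)$ from $Q$, with joint law $Q^n$. Let $I_l$ be the dyadic partition of $(0,1]$ into the intervals $(i2^{-l},(i+1)2^{-l}]$, $0\le i<2^l$ (used for $X$), and $J_l$ the same partition (used for $Y$); $I^{left},I^{right}$ are the two halves of $I$. Let $k_1=k_1(n)$, $k_2=k_2(n)$ be depths that are fixed or $O(\log n)$. The windows are $I\times J$ with $I\in I_{l_1}$, $J\in J_{l_2}$, $0\le l_1<k_1$, $0\le l_2<k_2$. A $T$-stratification of $\mathcal Z$ is a partition of $\mathcal Z$ into $T$ measurable sets; $h$ is the largest Euclidean diameter of its strata. Write $n(A,B,S)=|\{i:X_i\in A,Y_i\in B,Z_i\in S\}|$. *Test.* For a window $I\times J$ with stratification $\mathcal S$ put $p(I,J,\mathcal S)=1-F_{\chi^2_1}(M_n^2)$, where $$M_n=\frac{\sum_{S\in\mathcal S}\bigl(n(I^{left},J^{left},S)-\mu_S\bigr)}{\sqrt{\sum_{S\in\mathcal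 S}\sigma_S^2}},\quad \mu_S=\frac{n(I^{left},J,S)\,n(I,J^{left},S)}{n(I,J,S)},\quad \sigma_S^2=\frac{n(I^{left},J,S)\,n(I^{right},J,S)\,n(I,J^{left},S)\,n(I,J^{right},S)}{n(I,J,S)^2\,(n(I,J,S)-1)},$$ with $0/0=0$. Fix thresholds $v_{all},v_{margin}\in\mathbb N$. A window is valid if it contains at least $v_{all}$ observations and each of its margins $n(I^{left},J,\mathcal Z)$, $n(I^{right},J,\mathcal Z)$, $n(I,J^{left},\mathcal Z)$, $n(I,J^{right},\mathcal Z)$ is at least $v_{margin}$. Let $L(l_1,l_2)$ be the number of valid windows of $I_{l_1}\times J_{l_2}$ and $U(k)$ the number of pairs $(l_1,l_2)$, $l_1<k_1$, $l_2<k_2$, $l_1+l_2=k$, with $L(l_1,l_2)>0$. Put $$\tilde p_{l_1,l_2}=1-\bigl(1-\min_{\text{valid }I\times J\in I_{l_1}\times J_{l_2}}p(I,J,\mathcal S_{IJ})\bigr)^{L(l_1,l_2)},\quad \tilde p_k=1-\bigl(1-\min_{l_1+l_2=k,\,L(l_1,l_2)>0}\tilde p_{l_1,l_2}\bigr)^{U(k)},\quad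 \tilde p=1-\bigl(1-\min_{0\le k\le k_1+k_2-2,\,U(k)>0}\tilde p_k\bigr)^{k_1+k_2-1}$$ ($\tilde p=1$ if no window is valid). For $\alpha\in(0,1)$ the corrected level of a window of $I_{l_1}\times J_{l_2}$, $l_1+l_2=k$, is $\alpha_n(I,J)=1-(1-\alpha)^{1/[(k_1+k_2-1)U(k)L(l_1,l_2)]}$; a valid window with $p(I,J,\mathcal S_{IJ})\le\alpha_n(I,J)$ is called significant. The global test rejects if $\tilde p\le\alpha$. *Signal window.* A fixed window $I\times J$, belonging to the scanned windows for all large $n$, with a (non-random) sequence of $T_n$-stratifications $\mathcal S_{IJ}=\mathcal S_{IJ}^{(n)}$ of $\mathcal Z$ with largest diameters $h_n$, is a signal window if $T_n\asymp n$, $h_n=o(n^{-1/2})$, and the law of $(x,y,Z)=(1_{X\in I^{left}},1_{Y\in J^{left}},Z)$ under $Q$ truncated (conditioned) to $I\times J\times\mathcal Z$ has the following property. For some version $q(x,y\mid z)$ of the conditional distribution of the binary pair given $Z=z$: each $q(x,y\mid\cdot)$ is continuous on $\mathcal Z$; the log odds ratio $\theta(z)=\log\frac{q(0,0\mid z)q(1,1\mid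 z)}{q(0,1\mid z)q(1,0\mid z)}$ is non-negative and finite for all $z\in\mathcal Z$ (so all four cells are positive) and positive with non-zero probability; and, with $D_H$ the Hellinger distance $D_H(P,P')^2=\frac12\sum(\sqrt{P}-\sqrt{P'})^2$, there is $L\ge0$ such that either (i) $D_H(q(\cdot,\cdot\mid z),q(\cdot,\cdot\mid z'))\le L\|z-z'\|$ for all $z,z'\in\mathcal Z$, or (ii) the same bound holds for each of the two marginal conditional distributions $q_X(\cdot\mid z)$ and $q_Y(\cdot\mid z)$, and $\min_{x,y}q(x,y\mid Z)>q_{min}$ almost surely for some $q_{min}\in(0,1)$. *Conclusion.* For every $\alpha\in(0,1)$: 1. For every signal window $I\times J$ the conditional $Q^n$-probability that it is significant, given the stratum-specific margins $\{n(I',(0,1],S):I'\in I_{k_1},S\in\mathcal S_{IJ}\}$ and $\{n((0,1],J',S):J'\in J_{k_2},S\in\mathcal S_{IJ}\}$, converges to $1$ in $Q^n$-probability; consequently the unconditional probability that it is significant tends to $1$. 2. If at least one signal window exists, then $\lim_{n\to\infty}Q^n\{\tilde p\le\alpha\}=1$, however the stratifications of the other windows are chosen (they may depend on the sample). -/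

import Mathlib

open MeasureTheory ProbabilityTheory Filter Asymptotics
open scoped ENNReal Topology

noncomputable section

namespace MultiCMH

/-! ### Dyadic partitions of `(0,1]` and scanning windows -/

/-- The `i`-th node (from the left) of level `l` of the dyadic tree of `(0,1]`,
the interval `(i/2^l, (i+1)/2^l]`. -/
def node (l i : ℕ) : Set ℝ := Set.Ioc ((i : ℝ) / 2 ^ l) (((i : ℝ) + 1) / 2 ^ l)

/-- Left child of `node l i`. -/
def nodeLeft (l i : ℕ) : Set ℝ := node (l + 1) (2 * i)

/-- Right child of `node l i`. -/
def nodeRight (l i : ℕ) : Set ℝ := node (l + 1) (2 * i + 1)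

theorem node_zero : node 0 0 = Set.Ioc (0 : ℝ) 1 := by simp [node]

/-- The children of the node `(a,b]` are `(a,c]` and `(c,b]` with `c = (a+b)/2`. -/
theorem node_children (l i : ℕ) (a b : ℝ) (ha : a = (i : ℝ) / 2 ^ l)
    (hb : b = ((i : ℝ) + 1) / 2 ^ l) :
    node l i = Set.Ioc a b ∧ nodeLeft l i = Set.Ioc a ((a + b) / 2) ∧
      nodeRight l i = Set.Ioc ((a + b) / 2) b := by
  subst ha hb
  have h : (2 : ℝ) ^ l ≠ 0 := by positivity
  refine ⟨rfl, ?_, ?_⟩ <;> simp only [nodeLeft, nodeRight, node] <;> push_cast <;> congr 1 <;>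
    field_simp <;> ring

/-- A window `I × J`, with `I` the node number `i` of level `l₁` of the tree of the `X`-space and
`J` the node number `j` of level `l₂` of the tree of the `Y`-space. -/
structure Window where
  l₁ : ℕ
  l₂ : ℕ
  i : Fin (2 ^ l₁)
  j : Fin (2 ^ l₂)

namespace Window
variable (w : Window)
def I : Set ℝ := node w.l₁ w.i
def ILeft : Set ℝ := nodeLeft w.l₁ w.i
def IRight : Set ℝ := nodeRight w.l₁ w.i
def J : Set ℝ := node w.l₂ w.j
def JLeft : Set ℝ := nodeLeft w.l₂ w.j
def JRight : Set ℝ := nodeRight w.l₂ w.j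
end Window

/-! ### Observations and stratifications -/

/-- An observation `(x, y, z)` with `z ∈ ℝ^d`. -/
abbrev Obs (d : ℕ) := ℝ × ℝ × EuclideanSpace ℝ (Fin d)

/-- A partition of `𝒵` into `T` measurable strata. -/
structure Stratification {d : ℕ} (𝒵 : Set (EuclideanSpace ℝ (Fin d))) where
  T : ℕ
  cell : Fin T → Set (EuclideanSpace ℝ (Fin d))
  measurable_cell : ∀ t, MeasurableSet (cell t)
  disjoint_cell : Pairwise fun t t' => Disjoint (cell t) (cell t')
  iUnion_cell : ⋃ t, cell t = 𝒵

/-- The largest Euclidean diameter of a stratum, in `[0, ∞]`. -/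
def Stratification.mesh {d : ℕ} {𝒵 : Set (EuclideanSpace ℝ (Fin d))}
    (S : Stratification 𝒵) : ℝ≥0∞ := ⨆ t, Metric.ediam (S.cell t)

section Sample
variable {d n : ℕ} {𝒵 : Set (EuclideanSpace ℝ (Fin d))}

open Classical in
/-- The number of observations with `x ∈ A`, `y ∈ B`, `z ∈ C`. -/
def count (s : Fin n → Obs d) (A B : Set ℝ) (C : Set (EuclideanSpace ℝ (Fin d))) : ℕ :=
  (Finset.univ.filter fun i => (s i).1 ∈ A ∧ (s i).2.1 ∈ B ∧ (s i).2.2 ∈ C).card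

/-! ### The Cochran–Mantel–Haenszel statistic and p-value of a window -/

/-- Null mean `μ_S` of `n(I^left, J^left, C)` given the margins in the stratum `C`
(`0` for an empty stratum). -/
def cmhMean (s : Fin n → Obs d) (w : Window) (C : Set (EuclideanSpace ℝ (Fin d))) : ℝ :=
  (count s w.ILeft w.J C : ℝ) * count s w.I w.JLeft C / count s w.I w.J C

/-- Null variance `σ²_S` (`0` for a stratum with at most one observation of the window). -/
def cmhVar (s : Fin n → Obs d) (w : Window) (C : Set (EuclideanSpace ℝ (Fin d))) : ℝ :=
  (count s w.ILeft w.J C : ℝ) * count s w.IRight w.J C * count s w.I w.JLeft C *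
      count s w.I w.JRight C /
    ((count s w.I w.J C : ℝ) ^ 2 * ((count s w.I w.J C : ℝ) - 1))

/-- The statistic `M_n(I, J, S)` (`0` if the total variance vanishes; every stratum table is then
determined by its margins and the numerator vanishes too). -/
def cmhStat (s : Fin n → Obs d) (w : Window) (S : Stratification 𝒵) : ℝ :=
  (∑ t, ((count s w.ILeft w.JLeft (S.cell t) : ℝ) - cmhMean s w (S.cell t))) /
    √(∑ t, cmhVar s w (S.cell t))

/-- The chi-squared distribution with one degree of freedom: the law of `G²`, `G ~ N(0,1)`. -/
def chiSqOne : Measure ℝ := (gaussianReal 0 1).map fun x => x ^ 2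

/-- `p(I, J, S) = 1 - F_{χ²₁}(M_n²)`. -/
def pValue (s : Fin n → Obs d) (w : Window) (S : Stratification 𝒵) : ℝ :=
  1 - cdf chiSqOne (cmhStat s w S ^ 2)

/-! ### Screening and the three-stage Šidák correction -/

/-- The screening rule `V(I, J) = 1`: the total count of the window is at least `vAll` and its
four aggregated margins are at least `vMargin`. -/
def Screened (vAll vMargin : ℕ) (s : Fin n → Obs d) (w : Window) : Prop :=
  vAll ≤ count s w.I w.J Set.univ ∧
    vMargin ≤ count s w.ILeft w.J Set.univ ∧ vMargin ≤ count s w.IRight w.J Set.univ ∧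
    vMargin ≤ count s w.I w.JLeft Set.univ ∧ vMargin ≤ count s w.I w.JRight Set.univ

open Classical in
/-- The windows of the product partition `I_{l₁} × J_{l₂}` that pass the screening. -/
def validWindows (vAll vMargin : ℕ) (s : Fin n → Obs d) (l₁ l₂ : ℕ) :
    Finset (Fin (2 ^ l₁) × Fin (2 ^ l₂)) :=
  Finset.univ.filter fun ij => Screened vAll vMargin s ⟨l₁, l₂, ij.1, ij.2⟩

/-- `L(l₁, l₂)`. -/
def numWindows (vAll vMargin : ℕ) (s : Fin n → Obs d) (l₁ l₂ : ℕ) : ℕ :=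
  (validWindows vAll vMargin s l₁ l₂).card

/-- The pairs `(l₁, l₂)` of parent levels, `l₁ < k₁` and `l₂ < k₂`, of resolution `l₁ + l₂ = k`
with `L(l₁, l₂) > 0`. -/
def validPartitions (vAll vMargin k₁ k₂ : ℕ) (s : Fin n → Obs d) (k : ℕ) : Finset (ℕ × ℕ) :=
  (Finset.range k₁ ×ˢ Finset.range k₂).filter fun l =>
    l.1 + l.2 = k ∧ 0 < numWindows vAll vMargin s l.1 l.2

/-- `U(k)`. -/
def numPartitions (vAll vMargin k₁ k₂ : ℕ) (s : Fin n → Obs d) (k : ℕ) : ℕ :=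
  (validPartitions vAll vMargin k₁ k₂ s k).card

open Classical in
/-- Minimum of finitely many p-values; `1` if there are none. -/
def minP {ι : Type} (F : Finset ι) (p : ι → ℝ) : ℝ :=
  if h : F.Nonempty then F.inf' h p else 1

/-- Partition-wise p-value `p̃_{l₁,l₂}`, where `strat w` is the stratification of window `w`. -/
def pPartition (vAll vMargin : ℕ) (strat : Window → Stratification 𝒵) (s : Fin n → Obs d)
    (l₁ l₂ : ℕ) : ℝ :=
  1 - (1 - minP (validWindows vAll vMargin s l₁ l₂) fun ij =>
      pValue s ⟨l₁, l₂, ij.1, ij.2⟩ (strat ⟨l₁, l₂, ij.1, ij.2⟩)) ^ numWindows vAll vMargin s l₁ l₂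

/-- Resolution-wise p-value `p̃_k`. -/
def pResolution (vAll vMargin k₁ k₂ : ℕ) (strat : Window → Stratification 𝒵)
    (s : Fin n → Obs d) (k : ℕ) : ℝ :=
  1 - (1 - minP (validPartitions vAll vMargin k₁ k₂ s k) fun l =>
      pPartition vAll vMargin strat s l.1 l.2) ^ numPartitions vAll vMargin k₁ k₂ s k

/-- Overall p-value `p̃`. The minimum runs over the resolutions `0 ≤ k ≤ k₁ + k₂ - 2` whose
p-value is computed, that is, with `U(k) > 0`. -/
def pOverall (vAll vMargin k₁ k₂ : ℕ) (strat : Window → Stratification 𝒵)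
    (s : Fin n → Obs d) : ℝ :=
  1 - (1 - minP ((Finset.range (k₁ + k₂ - 1)).filter fun k =>
        0 < numPartitions vAll vMargin k₁ k₂ s k) fun k =>
      pResolution vAll vMargin k₁ k₂ strat s k) ^ (k₁ + k₂ - 1)

/-- Corrected level `α_n(I, J) = 1 - (1 - α)^{1/[(k₁ + k₂ - 1) U(l₁ + l₂) L(l₁, l₂)]}`. -/
def windowLevel (vAll vMargin k₁ k₂ : ℕ) (α : ℝ) (s : Fin n → Obs d) (w : Window) : ℝ :=
  1 - (1 - α) ^ ((1 : ℝ) / (((k₁ : ℝ) + k₂ - 1) *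
    numPartitions vAll vMargin k₁ k₂ s (w.l₁ + w.l₂) * numWindows vAll vMargin s w.l₁ w.l₂))

/-- The window passes the screening and `p(I, J, S) ≤ α_n(I, J)`. -/
def Significant (vAll vMargin k₁ k₂ : ℕ) (α : ℝ) (s : Fin n → Obs d) (w : Window)
    (S : Stratification 𝒵) : Prop :=
  Screened vAll vMargin s w ∧ pValue s w S ≤ windowLevel vAll vMargin k₁ k₂ α s w

/-- The stratum-specific margins `n(I_{k₁}, J₀, S)` and `n(I₀, J_{k₂}, S)`. -/
def margins (k₁ k₂ : ℕ) (S : Stratification 𝒵) (s : Fin n → Obs d) :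
    (Fin (2 ^ k₁) → Fin S.T → ℕ) × (Fin (2 ^ k₂) → Fin S.T → ℕ) :=
  (fun i t => count s (node k₁ i) (node 0 0) (S.cell t),
    fun j t => count s (node 0 0) (node k₂ j) (S.cell t))

end Sample

/-! ### Conditions on the induced binary triple -/

/-- Hellinger distance of two probability distributions on a finite set. -/
def hellinger {A : Type} [Fintype A] [MeasurableSpace A] (μ ν : Measure A) : ℝ :=
  √((1 / 2) * ∑ a, (√(μ.real {a}) - √(ν.real {a})) ^ 2)

section Binary
variable {d : ℕ}

/-- A Markov kernel giving the conditional distribution of a binary pair given `Z`. -/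
abbrev BinKernel (d : ℕ) := Kernel (EuclideanSpace ℝ (Fin d)) (Bool × Bool)

/-- Conditional log odds ratio `θ(z)`, valued in `[-∞, ∞]`; it is finite exactly when all four cell
probabilities at `z` are positive. -/
def logOddsRatio (κ : BinKernel d) (z : EuclideanSpace ℝ (Fin d)) : EReal :=
  ENNReal.log ((κ z {(false, false)} * κ z {(true, true)}) /
    (κ z {(false, true)} * κ z {(true, false)}))

def JointlySmooth (𝒵 : Set (EuclideanSpace ℝ (Fin d))) (κ : BinKernel d) : Prop :=
  ∃ L : ℝ, 0 ≤ L ∧ ∀ z ∈ 𝒵, ∀ z' ∈ 𝒵, hellinger (κ z) (κ z') ≤ L * dist z z'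

def MarginallySmooth (𝒵 : Set (EuclideanSpace ℝ (Fin d))) (κ : BinKernel d) : Prop :=
  ∃ L : ℝ, 0 ≤ L ∧ ∀ z ∈ 𝒵, ∀ z' ∈ 𝒵,
    max (hellinger ((κ z).map Prod.fst) ((κ z').map Prod.fst))
      (hellinger ((κ z).map Prod.snd) ((κ z').map Prod.snd)) ≤ L * dist z z'

/-- The conditions of the binary consistency theorem on the law `ρ` of `(Z, (X, Y))`, with
binary `X`, `Y`: for some version `κ` of the conditional distribution of `(X, Y)` given `Z`,
the cell probabilities are continuous on `𝒵`, the log odds ratio is non-negative and finite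
on `𝒵` and positive with non-zero probability, and either (i) `κ` is jointly smooth or
(ii) `κ` is marginally smooth with cell probabilities almost surely bounded below. -/
def ConsistencyConditions (𝒵 : Set (EuclideanSpace ℝ (Fin d)))
    (ρ : Measure (EuclideanSpace ℝ (Fin d) × (Bool × Bool))) : Prop :=
  ∃ κ : BinKernel d, IsMarkovKernel κ ∧ ρ.IsCondKernel κ ∧
    (∀ a, ContinuousOn (fun z => (κ z).real {a}) 𝒵) ∧
    (∀ z ∈ 𝒵, 0 ≤ logOddsRatio κ z ∧ logOddsRatio κ z < ⊤) ∧
    0 < ρ.fst {z | z ∈ 𝒵 ∧ 0 < logOddsRatio κ z} ∧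
    (JointlySmooth 𝒵 κ ∨
      MarginallySmooth 𝒵 κ ∧ ∃ q : ℝ, 0 < q ∧ q < 1 ∧
        ∀ᵐ z ∂ρ.fst, ∀ a, q < (κ z).real {a})

open Classical in
/-- The law of `(Z, (1{X ∈ I^left}, 1{Y ∈ J^left}))` when `(X, Y, Z)` follows the truncation of
`Q` to `I × J × 𝒵`. -/
def inducedTriple (𝒵 : Set (EuclideanSpace ℝ (Fin d))) (Q : Measure (Obs d)) (w : Window) :
    Measure (EuclideanSpace ℝ (Fin d) × (Bool × Bool)) :=
  (cond Q (w.I ×ˢ w.J ×ˢ 𝒵)).map fun o => (o.2.2, decide (o.1 ∈ w.ILeft), decide (o.2.1 ∈ w.JLeft))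

/-- The window `w` and a sequence `S n` of stratifications (one for each sample size `n`) satisfy
the hypotheses of local consistency: the induced binary triple meets the conditions of the binary
consistency theorem, `T ≍ n`, and `h = o(n^{-1/2})`. -/
def SignalWindow (𝒵 : Set (EuclideanSpace ℝ (Fin d))) (Q : Measure (Obs d)) (w : Window)
    (S : ℕ → Stratification 𝒵) : Prop :=
  ConsistencyConditions 𝒵 (inducedTriple 𝒵 Q w) ∧
    (fun n => ((S n).T : ℝ)) =Θ[atTop] (fun n => (n : ℝ)) ∧
    Tendsto (fun n : ℕ => (S n).mesh * ENNReal.ofReal (√n)) atTop (𝓝 0)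

end Binary

end MultiCMH

end

namespace MultiCMH

/-! ### Variance of functions with bounded differences -/

/-! Fix a signal window and let `D` be the numerator of its statistic, the sum over strata of
observed minus null mean. The whole theorem reduces to `D ≥ c n` for some `c > 0`, with probability
tending to one; crude bounds then suffice. The summed variance is at most `n`, so `M_n² ≥ D² / n`,
and Markov's inequality for the chi-squared law gives a p-value of at most `n / D²`, which is
`O(1/n)`. The corrected level of a fixed window is at least a constant over `k₁ + k₂ = O(log n)`,
because `U` and `L` are bounded in terms of its fixed levels. Screening is automatic, since `D` is
at most each aggregated margin.

Mean of `D`: in a stratum the deviation is a sum over ordered pairs of distinct observations,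
divided by the stratum count (`tableDev_eq_sum`). Given that both members of a pair hit, the
remaining observations are independent of them, so the mean is a weight times the excess `p_{AB} p -
p_A p_B` (`integral_tableDev`). By the law of total covariance the excess comes from the mean
conditional covariance of the binary pair, non-negative because the odds ratio is at least one, and
from the covariance of the conditional marginals, which is at least `-O(h²)` because they are
Lipschitz. Each weight is at least `n (n - 1) / (2 + n p)`, so Cauchy–Schwarz over the `T = O(n)`
strata yields a main term linear in `n` and an error `o(n)` (`le_integral_totalDev`,
`exists_linear_le_integral_totalDev`).

Concentration: replacing one observation moves `D` by at most 2, however many strata there are, so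
the variance of `D` is at most `4 n` and Chebyshev's inequality applies (`measure_totalDev_lt_le`).

Conditioning costs nothing: a conditional probability is at most one, so if its mean tends to one it
tends to one in probability. Globally, the exponents of the three Šidák stages multiply to the
exponent in the corrected level, so one significant window forces rejection. -/

theorem abs_integral_sub_integral_le {Ω : Type*} [MeasurableSpace Ω] {μ : Measure Ω}
    [IsProbabilityMeasure μ] {f g : Ω → ℝ} (hf : Integrable f μ) (hg : Integrable g μ) {c : ℝ}
    (h : ∀ x, |f x - g x| ≤ c) : |∫ x, f x ∂μ - ∫ x, g x ∂μ| ≤ c := by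
  rw [← integral_sub hf hg]
  refine (abs_integral_le_integral_abs).trans ?_
  calc ∫ x, |f x - g x| ∂μ ≤ ∫ _, c ∂μ :=
        integral_mono (hf.sub hg).abs (integrable_const _) h
    _ = c := by simp

theorem integrable_of_abs_le {Ω : Type*} [MeasurableSpace Ω] {μ : Measure Ω}
    [IsFiniteMeasure μ] {f : Ω → ℝ} (hf : Measurable f) {B : ℝ} (h : ∀ x, |f x| ≤ B) :
    Integrable f μ :=
  Integrable.of_bound hf.aestronglyMeasurable B (ae_of_all _ h)

theorem integral_pi_succ {Ω : Type*} [MeasurableSpace Ω] (μ : Measure Ω)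
    [IsProbabilityMeasure μ] {n : ℕ} {f : (Fin (n + 1) → Ω) → ℝ} (hf : Measurable f) {B : ℝ}
    (hB : ∀ s, |f s| ≤ B) :
    ∫ s, f s ∂(Measure.pi fun _ => μ) =
      ∫ x, ∫ s, f (Fin.cons x s) ∂(Measure.pi fun _ : Fin n => μ) ∂μ := by
  have hmp := (measurePreserving_piFinSuccAbove (fun _ : Fin (n + 1) => μ) 0).symm
  rw [← hmp.integral_comp (MeasurableEquiv.measurableEmbedding _) f]
  have hi : Integrable (fun y : Ω × (Fin n → Ω) =>
      f ((MeasurableEquiv.piFinSuccAbove (fun _ : Fin (n + 1) => Ω) 0).symm y))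
      (μ.prod (Measure.pi fun _ : Fin n => μ)) :=
    integrable_of_abs_le (hf.comp (MeasurableEquiv.measurable _)) (fun _ => hB _)
  refine (integral_prod _ hi).trans ?_
  refine integral_congr_ae (ae_of_all _ fun x => integral_congr_ae (ae_of_all _ fun s => ?_))
  simp [MeasurableEquiv.piFinSuccAbove, Fin.insertNthEquiv]

theorem measurable_fin_cons {Ω : Type*} [MeasurableSpace Ω] {n : ℕ} :
    Measurable fun p : Ω × (Fin n → Ω) => (Fin.cons p.1 p.2 : Fin (n + 1) → Ω) := by
  refine measurable_pi_lambda _ fun i => ?_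
  refine Fin.cases ?_ (fun j => ?_) i
  · simpa using measurable_fst
  · simpa [Function.comp_def] using (measurable_pi_apply j).comp measurable_snd

/-- A function of `n` independent variables with differences bounded by `c` has variance at most
`n c²`. -/
theorem integral_sq_sub_integral_le_of_bounded_differences {Ω : Type*} [MeasurableSpace Ω]
    (μ : Measure Ω) [IsProbabilityMeasure μ] {c : ℝ} (n : ℕ) (f : (Fin n → Ω) → ℝ)
    (hf : Measurable f) {B : ℝ} (hB : ∀ s, |f s| ≤ B)
    (hc : ∀ s i x, |f (Function.update s i x) - f s| ≤ c) :
    ∫ s, (f s - ∫ s', f s' ∂(Measure.pi fun _ => μ)) ^ 2 ∂(Measure.pi fun _ => μ) ≤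
      n * c ^ 2 := by
  induction n with
  | zero =>
    have h : ∀ s, f s = f default := fun s => congrArg f (Subsingleton.elim _ _)
    simp [h]
  | succ n ih =>
    set ν := Measure.pi fun _ : Fin n => μ
    set m := ∫ s', f s' ∂(Measure.pi fun _ => μ) with hm
    set g : Ω → ℝ := fun x => ∫ s, f (Fin.cons x s) ∂ν with hg
    have hmeas : Measurable fun p : Ω × (Fin n → Ω) => f (Fin.cons p.1 p.2) :=
      hf.comp measurable_fin_cons
    have hmx : ∀ x, Measurable fun s : Fin n → Ω => f (Fin.cons x s) := fun x =>
      hmeas.comp measurable_prodMk_left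
    have hix : ∀ x, Integrable (fun s : Fin n → Ω => f (Fin.cons x s)) ν := fun x =>
      integrable_of_abs_le (hmx x) (fun s => hB _)
    have hgm : Measurable g := hmeas.stronglyMeasurable.integral_prod_right.measurable
    have hgB : ∀ x, |g x| ≤ B := fun x => by
      simpa using abs_integral_sub_integral_le (hix x) (integrable_zero _ _ ν)
        (c := B) (fun s => by simpa using hB _)
    have hmg : m = ∫ x, g x ∂μ := integral_pi_succ μ hf hB
    -- The two integrands differ only in coordinate 0, so the bounded difference survives averaging
    -- over the others.
    have hgg : ∀ x x', |g x - g x'| ≤ c := fun x x' =>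
      abs_integral_sub_integral_le (hix x) (hix x') fun s => by
        have := hc (Fin.cons x' s) 0 x
        rwa [Fin.update_cons_zero] at this
    have hgm' : ∀ x, |g x - m| ≤ c := fun x => by
      have := abs_integral_sub_integral_le (μ := μ) (integrable_const (g x))
        (integrable_of_abs_le hgm hgB) (hgg x)
      simpa [← hmg] using this
    have hmB : |m| ≤ B := by
      have := abs_integral_sub_integral_le (μ := μ) (integrable_of_abs_le hgm hgB)
        (integrable_zero _ _ μ) (c := B) (fun x => by simpa using hgB x)
      simpa [← hmg] using this
    have hB0 : 0 ≤ B := (abs_nonneg _).trans hmB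
    have hsq : ∀ s, |(f s - m) ^ 2| ≤ (2 * B) ^ 2 := fun s => by
      rw [abs_pow]
      refine pow_le_pow_left₀ (abs_nonneg _) ?_ 2
      exact (abs_sub _ _).trans (by linarith [hB s])
    rw [integral_pi_succ μ ((hf.sub_const m).pow_const 2) hsq]
    -- For fixed first coordinate, the second moment about `m` is the variance of the section, at
    -- most `n c²` by induction, plus the squared bias `(g x - m)² ≤ c²`.
    have key : ∀ x, ∫ s, (f (Fin.cons x s) - m) ^ 2 ∂ν ≤ n * c ^ 2 + c ^ 2 := fun x => by
      have h1 := ih (fun s => f (Fin.cons x s)) (hmx x) (fun s => hB _) (fun s i y => by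
        have := hc (Fin.cons x s) i.succ y
        rwa [← Fin.cons_update] at this)
      have h2 : ∫ s, (f (Fin.cons x s) - m) ^ 2 ∂ν =
          ∫ s, (f (Fin.cons x s) - g x) ^ 2 ∂ν + (g x - m) ^ 2 := by
        have e : ∀ s : Fin n → Ω, (f (Fin.cons x s) - m) ^ 2 = (f (Fin.cons x s) - g x) ^ 2 +
            (2 * (g x - m) * (f (Fin.cons x s) - g x) + (g x - m) ^ 2) := fun s => by ring
        have i1 : Integrable (fun s : Fin n → Ω => (f (Fin.cons x s) - g x) ^ 2) ν := by
          refine integrable_of_abs_le (((hmx x).sub_const _).pow_const 2) (B := (2 * B) ^ 2)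
            fun s => ?_
          rw [abs_pow]
          refine pow_le_pow_left₀ (abs_nonneg _) ?_ 2
          exact (abs_sub _ _).trans (by linarith [hB (Fin.cons x s), hgB x])
        have i2 : Integrable (fun s : Fin n → Ω => 2 * (g x - m) * (f (Fin.cons x s) - g x)) ν :=
          ((hix x).sub (integrable_const _)).const_mul _
        have i3 : Integrable (fun s : Fin n → Ω =>
            2 * (g x - m) * (f (Fin.cons x s) - g x) + (g x - m) ^ 2) ν :=
          i2.add (integrable_const _)
        simp_rw [e]
        rw [integral_add i1 i3, integral_add i2 (integrable_const _),
          integral_const_mul, integral_sub (hix x) (integrable_const _)]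
        simp [hg]
      have h3 : (g x - m) ^ 2 ≤ c ^ 2 := sq_le_sq' (by linarith [abs_le.1 (hgm' x)])
        (abs_le.1 (hgm' x)).2
      linarith
    have hint : Integrable (fun x => ∫ s, (f (Fin.cons x s) - m) ^ 2 ∂ν) μ := by
      refine integrable_of_abs_le (B := (2 * B) ^ 2)
        (((hmeas.sub_const m).pow_const 2).stronglyMeasurable.integral_prod_right.measurable)
        fun x => ?_
      simpa using abs_integral_sub_integral_le (μ := ν)
        (integrable_of_abs_le (((hmx x).sub_const m).pow_const 2) (fun s => hsq _))
        (integrable_zero _ _ ν) (c := (2 * B) ^ 2) (fun s => by simpa using hsq _)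
    calc _ ≤ ∫ _, (n * c ^ 2 + c ^ 2 : ℝ) ∂μ := integral_mono hint (integrable_const _) key
      _ = _ := by simp; ring

/-! ### Counting hits of a set and the deviation of a two by two table from its null mean -/

section Table
variable {Ω : Type*} {n : ℕ}

/-- The number of coordinates of `s` in `E`. -/
noncomputable def hits (E : Set Ω) (s : Fin n → Ω) : ℝ := ∑ i, E.indicator 1 (s i)

theorem indicator_one_nonneg (E : Set Ω) (x : Ω) : (0 : ℝ) ≤ E.indicator 1 x :=
  Set.indicator_nonneg (fun _ _ => zero_le_one) x

theorem indicator_one_le_one (E : Set Ω) (x : Ω) : E.indicator (1 : Ω → ℝ) x ≤ 1 :=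
  Set.indicator_le_self' (fun _ _ => zero_le_one) x

theorem indicator_one_mono {E F : Set Ω} (h : E ⊆ F) (x : Ω) :
    E.indicator (1 : Ω → ℝ) x ≤ F.indicator 1 x :=
  Set.indicator_le_indicator_of_subset h (fun _ => zero_le_one) x

theorem hits_nonneg (E : Set Ω) (s : Fin n → Ω) : 0 ≤ hits E s :=
  Finset.sum_nonneg fun _ _ => indicator_one_nonneg _ _

theorem hits_mono {E F : Set Ω} (h : E ⊆ F) (s : Fin n → Ω) : hits E s ≤ hits F s :=
  Finset.sum_le_sum fun _ _ => indicator_one_mono h _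

theorem hits_le (E : Set Ω) (s : Fin n → Ω) : hits E s ≤ n := by
  calc hits E s ≤ ∑ _i : Fin n, (1 : ℝ) := Finset.sum_le_sum fun _ _ => indicator_one_le_one _ _
    _ = n := by simp

theorem measurable_indicator_one [MeasurableSpace Ω] {E : Set Ω} (hE : MeasurableSet E) :
    Measurable (E.indicator (1 : Ω → ℝ)) := measurable_one.indicator hE

theorem measurable_hits [MeasurableSpace Ω] {E : Set Ω} (hE : MeasurableSet E) :
    Measurable fun s : Fin n → Ω => hits E s :=
  Finset.measurable_sum _ fun i _ => (measurable_indicator_one hE).comp (measurable_pi_apply i)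

/-- In the `2 × 2` table of the observations in `U`, classified by `A` and by `B`, the difference
of the `A ∩ B` count and its null mean given the margins. -/
noncomputable def tableDev (U A B : Set Ω) (s : Fin n → Ω) : ℝ :=
  hits (U ∩ (A ∩ B)) s - hits (U ∩ A) s * hits (U ∩ B) s / hits U s

theorem measurable_tableDev [MeasurableSpace Ω] {U A B : Set Ω} (hU : MeasurableSet U)
    (hA : MeasurableSet A) (hB : MeasurableSet B) :
    Measurable fun s : Fin n → Ω => tableDev U A B s :=
  (measurable_hits (hU.inter (hA.inter hB))).sub
    (((measurable_hits (hU.inter hA)).mul (measurable_hits (hU.inter hB))).div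
      (measurable_hits hU))

/-- One observation with indicators `x`, `y` joins a table of size `m` with margins `b`, `c`. The
change of the deviation is exactly `m / (m + 1) * (x - b / m) * (y - c / m)`, and each factor has
modulus at most 1. -/
theorem abs_add_sub_div_sub_le {a b c m x y : ℝ} (hb : 0 ≤ b) (hbm : b ≤ m) (hc : 0 ≤ c)
    (hcm : c ≤ m) (hx : 0 ≤ x) (hx1 : x ≤ 1) (hy : 0 ≤ y) (hy1 : y ≤ 1) :
    |(a + x * y) - (b + x) * (c + y) / (m + 1) - (a - b * c / m)| ≤ 1 := by
  rcases (hb.trans hbm).eq_or_lt with h0 | h0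
  · have hb0 : b = 0 := by linarith
    have hc0 : c = 0 := by linarith
    subst hb0 hc0
    simp [← h0]
  · have e : (a + x * y) - (b + x) * (c + y) / (m + 1) - (a - b * c / m) =
        m / (m + 1) * ((x - b / m) * (y - c / m)) := by
      field_simp
      ring
    have hbm1 : b / m ≤ 1 := (div_le_one h0).2 hbm
    have hcm1 : c / m ≤ 1 := (div_le_one h0).2 hcm
    have hb1 : 0 ≤ b / m := by positivity
    have hc1 : 0 ≤ c / m := by positivity
    rw [e, abs_mul, abs_mul]
    have h1 : |m / (m + 1)| ≤ 1 := by
      rw [abs_of_nonneg (by positivity)]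
      exact (div_le_one (by linarith)).2 (by linarith)
    have h2 : |x - b / m| ≤ 1 := abs_le.2 ⟨by linarith, by linarith⟩
    have h3 : |y - c / m| ≤ 1 := abs_le.2 ⟨by linarith, by linarith⟩
    exact mul_le_one₀ h1 (by positivity) (mul_le_one₀ h2 (by positivity) h3)

theorem hits_update (E : Set Ω) (s : Fin n → Ω) (i : Fin n) (x : Ω) :
    hits E (Function.update s i x) =
      ∑ j ∈ Finset.univ.erase i, E.indicator 1 (s j) + E.indicator 1 x := by
  rw [hits, ← Finset.sum_erase_add _ _ (Finset.mem_univ i), Function.update_self]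
  congr 1
  refine Finset.sum_congr rfl fun j hj => ?_
  rw [Function.update_of_ne (Finset.ne_of_mem_erase hj)]

/-- Both tables are compared with the one lacking observation `i`. Keeping the indicators in the
bound, rather than 2, lets it be summed over disjoint strata. -/
theorem abs_tableDev_update_sub_le (U A B : Set Ω) (s : Fin n → Ω) (i : Fin n) (x : Ω) :
    |tableDev U A B (Function.update s i x) - tableDev U A B s| ≤
      U.indicator 1 x + U.indicator 1 (s i) := by
  set R : Set Ω → ℝ := fun E => ∑ j ∈ Finset.univ.erase i, E.indicator 1 (s j) with hR
  have hR0 : ∀ E, 0 ≤ R E := fun E => Finset.sum_nonneg fun _ _ => indicator_one_nonneg _ _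
  have hRm : ∀ E, R (U ∩ E) ≤ R U := fun E =>
    Finset.sum_le_sum fun _ _ => indicator_one_mono Set.inter_subset_left _
  have key : ∀ y, |tableDev U A B (Function.update s i y) -
      (R (U ∩ (A ∩ B)) - R (U ∩ A) * R (U ∩ B) / R U)| ≤ U.indicator 1 y := fun y => by
    simp only [tableDev, hits_update]
    change |R _ + _ - (R _ + _) * (R _ + _) / (R _ + _) - _| ≤ _
    by_cases hU : y ∈ U
    · have e1 : (U ∩ (A ∩ B)).indicator (1 : Ω → ℝ) y =
          (U ∩ A).indicator 1 y * (U ∩ B).indicator 1 y := by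
        by_cases hA : y ∈ A <;> by_cases hB : y ∈ B <;> simp [hU, hA, hB]
      have e2 : U.indicator (1 : Ω → ℝ) y = 1 := by simp [hU]
      rw [e1, e2]
      exact abs_add_sub_div_sub_le (hR0 _) (hRm _) (hR0 _) (hRm _) (indicator_one_nonneg _ _)
        (indicator_one_le_one _ _) (indicator_one_nonneg _ _) (indicator_one_le_one _ _)
    · simp [hU]
  have h1 := key x
  have h2 := key (s i)
  rw [Function.update_eq_self] at h2
  rw [abs_sub_comm] at h2
  exact (abs_sub_le _ _ _).trans (add_le_add h1 h2)

/-- Multiplying and dividing the `A ∩ B` count by the table total makes both terms double sums.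
Dropping the diagonal leaves pairs of independent observations, whose expectations factor. -/
theorem tableDev_eq_sum (U A B : Set Ω) (s : Fin n → Ω) :
    tableDev U A B s = ∑ i, ∑ j ∈ Finset.univ.erase i,
      ((U ∩ (A ∩ B)).indicator 1 (s i) * U.indicator 1 (s j) / hits U s -
        (U ∩ A).indicator 1 (s i) * (U ∩ B).indicator 1 (s j) / hits U s) := by
  have h1 : ∀ i, ∑ j ∈ Finset.univ.erase i,
      ((U ∩ (A ∩ B)).indicator (1 : Ω → ℝ) (s i) * U.indicator 1 (s j) / hits U s -
        (U ∩ A).indicator 1 (s i) * (U ∩ B).indicator 1 (s j) / hits U s) =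
      ∑ j, ((U ∩ (A ∩ B)).indicator (1 : Ω → ℝ) (s i) * U.indicator 1 (s j) / hits U s -
        (U ∩ A).indicator 1 (s i) * (U ∩ B).indicator 1 (s j) / hits U s) := fun i => by
    -- At `j = i` both terms equal the indicator of `U ∩ (A ∩ B)` over the total, so the diagonal
    -- cancels.
    refine Finset.sum_erase _ ?_
    by_cases hU : s i ∈ U <;> by_cases hA : s i ∈ A <;> by_cases hB : s i ∈ B <;>
      simp [hU, hA, hB]
  simp_rw [h1, Finset.sum_sub_distrib, ← Finset.sum_div, ← Finset.sum_mul_sum]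
  change _ = hits _ s * hits _ s / hits _ s - hits _ s * hits _ s / hits _ s
  rw [tableDev]
  congr 1
  rcases (hits_nonneg U s).eq_or_lt with h0 | h0
  · have := hits_nonneg (U ∩ (A ∩ B)) s
    have := hits_mono (Set.inter_subset_left : U ∩ (A ∩ B) ⊆ U) s
    simp only [← h0, div_zero]
    linarith
  · field_simp

end Table

end MultiCMH

namespace MultiCMH

/-! ### Mean deviation of a single table -/

section Expectation
variable {Ω : Type*} [MeasurableSpace Ω] {n : ℕ}

/-- Mean reciprocal of the number of hits of `U`, given that the coordinates `i` and `j` hit. -/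
noncomputable def meanInvHits (μ : Measure Ω) (U : Set Ω) (i j : Fin n) : ℝ :=
  ∫ s, (2 + ∑ k ∈ (Finset.univ.erase i).erase j, U.indicator 1 (s k))⁻¹
    ∂(Measure.pi fun _ : Fin n => μ)

theorem integrable_mul_div_hits (μ : Measure Ω) [IsProbabilityMeasure μ] {U E F : Set Ω}
    (hU : MeasurableSet U) (hE : MeasurableSet E) (hF : MeasurableSet F) (hEU : E ⊆ U)
    (i j : Fin n) : Integrable
      (fun s : Fin n → Ω => E.indicator 1 (s i) * F.indicator 1 (s j) / hits U s)
      (Measure.pi fun _ => μ) := by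
  refine integrable_of_abs_le (B := 1) ?_ fun s => ?_
  · exact (((measurable_indicator_one hE).comp (measurable_pi_apply i)).mul
      ((measurable_indicator_one hF).comp (measurable_pi_apply j))).div (measurable_hits hU)
  · rw [abs_of_nonneg (div_nonneg (mul_nonneg (indicator_one_nonneg _ _)
      (indicator_one_nonneg _ _)) (hits_nonneg _ _))]
    refine div_le_one_of_le₀ ?_ (hits_nonneg _ _)
    calc E.indicator (1 : Ω → ℝ) (s i) * F.indicator 1 (s j) ≤ E.indicator 1 (s i) :=
          mul_le_of_le_one_right (indicator_one_nonneg _ _) (indicator_one_le_one _ _)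
      _ ≤ U.indicator 1 (s i) := indicator_one_mono hEU _
      _ ≤ hits U s := Finset.single_le_sum (f := fun i => U.indicator (1 : Ω → ℝ) (s i))
          (fun _ _ => indicator_one_nonneg _ _) (Finset.mem_univ i)

theorem integral_indicator_eval (μ : Measure Ω) [IsProbabilityMeasure μ] {E : Set Ω}
    (hE : MeasurableSet E) (k : Fin n) :
    ∫ s : Fin n → Ω, E.indicator (1 : Ω → ℝ) (s k) ∂(Measure.pi fun _ => μ) = μ.real E := by
  have hmp := measurePreserving_eval (fun _ : Fin n => μ) k
  rw [← integral_indicator_one hE]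
  conv_rhs => rw [← hmp.map_eq]
  exact (integral_map (measurable_pi_apply k).aemeasurable
    (measurable_indicator_one hE).aestronglyMeasurable).symm

/-- Where the integrand is non-zero, both `i` and `j` hit `U`, so the total is 2 plus the hits among
the other coordinates. That expression is independent of coordinates `i` and `j`, which are
independent of each other. -/
theorem integral_mul_div_hits (μ : Measure Ω) [IsProbabilityMeasure μ] {U E F : Set Ω}
    (hU : MeasurableSet U) (hE : MeasurableSet E) (hF : MeasurableSet F) (hEU : E ⊆ U)
    (hFU : F ⊆ U) {i j : Fin n} (hij : j ≠ i) :
    ∫ s, E.indicator 1 (s i) * F.indicator 1 (s j) / hits U s ∂(Measure.pi fun _ => μ) =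
      meanInvHits μ U i j * (μ.real E * μ.real F) := by
  set P := Measure.pi fun _ : Fin n => μ
  have hind : iIndepFun (fun (k : Fin n) (s : Fin n → Ω) => s k) P :=
    iIndepFun_pi (X := fun _ => id) fun _ => aemeasurable_id
  have hm : ∀ k : Fin n, Measurable fun s : Fin n → Ω => s k := measurable_pi_apply
  have hdisj : Disjoint ((Finset.univ.erase i).erase j) {i, j} := by
    rw [Finset.disjoint_left]
    intro k hk
    simp only [Finset.mem_erase] at hk
    simp [hk.1, hk.2.1]
  have h1 := hind.indepFun_finset _ _ hdisj hm
  have hr : Measurable fun t : ((Finset.univ.erase i).erase j : Finset (Fin n)) → Ω =>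
      (2 + ∑ k, U.indicator (1 : Ω → ℝ) (t k))⁻¹ :=
    (measurable_const.add (Finset.measurable_sum _ fun k _ =>
      (measurable_indicator_one hU).comp (measurable_pi_apply k))).inv
  have hq : Measurable fun t : ({i, j} : Finset (Fin n)) → Ω =>
      E.indicator (1 : Ω → ℝ) (t ⟨i, by simp⟩) * F.indicator 1 (t ⟨j, by simp⟩) :=
    ((measurable_indicator_one hE).comp (measurable_pi_apply _)).mul
      ((measurable_indicator_one hF).comp (measurable_pi_apply _))
  have h2 := h1.comp hr hq
  have h3 := h2.integral_fun_mul_eq_mul_integral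
    (hr.comp (measurable_pi_lambda _ fun k => hm k)).aestronglyMeasurable
    (hq.comp (measurable_pi_lambda _ fun k => hm k)).aestronglyMeasurable
  have h4 := ((hind.indepFun hij.symm).comp (measurable_indicator_one hE)
    (measurable_indicator_one hF)).integral_fun_mul_eq_mul_integral
    ((measurable_indicator_one hE).comp (hm i)).aestronglyMeasurable
    ((measurable_indicator_one hF).comp (hm j)).aestronglyMeasurable
  simp only [Function.comp_def] at h3 h4
  rw [integral_indicator_eval μ hE i, integral_indicator_eval μ hF j] at h4
  rw [h4] at h3
  have e1 : ∀ s : Fin n → Ω, ∑ k : ((Finset.univ.erase i).erase j : Finset (Fin n)),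
      U.indicator (1 : Ω → ℝ) (s k) =
      ∑ k ∈ (Finset.univ.erase i).erase j, U.indicator 1 (s k) := fun s =>
    Finset.sum_coe_sort _ fun k => U.indicator (1 : Ω → ℝ) (s k)
  simp only [e1] at h3
  rw [meanInvHits, ← h3]
  refine integral_congr_ae (ae_of_all _ fun s => ?_)
  dsimp only
  by_cases hsE : s i ∈ E
  · by_cases hsF : s j ∈ F
    · have : hits U s = 2 + ∑ k ∈ (Finset.univ.erase i).erase j, U.indicator 1 (s k) := by
        rw [hits, ← Finset.add_sum_erase _ _ (Finset.mem_univ i),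
          ← Finset.add_sum_erase _ _ (Finset.mem_erase.2 ⟨hij, Finset.mem_univ j⟩)]
        simp only [Set.indicator_of_mem (hEU hsE), Set.indicator_of_mem (hFU hsF), Pi.one_apply]
        ring
      rw [this, div_eq_inv_mul]
    · simp [hsF]
  · simp [hsE]

/-- Sum of `meanInvHits` over all ordered pairs of distinct coordinates. -/
noncomputable def pairWeight (μ : Measure Ω) (U : Set Ω) (n : ℕ) : ℝ :=
  ∑ i : Fin n, ∑ j ∈ Finset.univ.erase i, meanInvHits μ U i j

theorem integrable_tableDev (μ : Measure Ω) [IsProbabilityMeasure μ] {U A B : Set Ω}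
    (hU : MeasurableSet U) (hA : MeasurableSet A) (hB : MeasurableSet B) :
    Integrable (fun s : Fin n → Ω => tableDev U A B s) (Measure.pi fun _ => μ) := by
  simp_rw [tableDev_eq_sum]
  exact integrable_finsetSum _ fun i _ => integrable_finsetSum _ fun j _ =>
    (integrable_mul_div_hits μ hU (hU.inter (hA.inter hB)) hU Set.inter_subset_left i j).sub
      (integrable_mul_div_hits μ hU (hU.inter hA) (hU.inter hB) Set.inter_subset_left i j)

theorem integral_tableDev (μ : Measure Ω) [IsProbabilityMeasure μ] {U A B : Set Ω}
    (hU : MeasurableSet U) (hA : MeasurableSet A) (hB : MeasurableSet B) :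
    ∫ s : Fin n → Ω, tableDev U A B s ∂(Measure.pi fun _ => μ) =
      pairWeight μ U n * (μ.real (U ∩ (A ∩ B)) * μ.real U - μ.real (U ∩ A) * μ.real (U ∩ B)) := by
  have i1 := fun i j : Fin n => integrable_mul_div_hits μ hU (hU.inter (hA.inter hB)) hU
    Set.inter_subset_left i j
  have i2 := fun i j : Fin n => integrable_mul_div_hits μ hU (hU.inter hA) (hU.inter hB)
    Set.inter_subset_left i j
  have i3 : ∀ i j : Fin n, Integrable (fun s : Fin n → Ω =>
      (U ∩ (A ∩ B)).indicator (1 : Ω → ℝ) (s i) * U.indicator 1 (s j) / hits U s -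
        (U ∩ A).indicator 1 (s i) * (U ∩ B).indicator 1 (s j) / hits U s)
      (Measure.pi fun _ => μ) := fun i j => (i1 i j).sub (i2 i j)
  simp_rw [tableDev_eq_sum]
  rw [integral_finsetSum _ fun i _ => integrable_finsetSum _ fun j _ => i3 i j,
    pairWeight, Finset.sum_mul]
  refine Finset.sum_congr rfl fun i _ => ?_
  rw [integral_finsetSum _ fun j _ => i3 i j, Finset.sum_mul]
  refine Finset.sum_congr rfl fun j hj => ?_
  have hij := Finset.ne_of_mem_erase hj
  rw [integral_sub (i1 i j) (i2 i j), integral_mul_div_hits μ hU (hU.inter (hA.inter hB)) hU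
    Set.inter_subset_left subset_rfl hij, integral_mul_div_hits μ hU (hU.inter hA) (hU.inter hB)
    Set.inter_subset_left Set.inter_subset_left hij]
  ring

theorem integral_hits (μ : Measure Ω) [IsProbabilityMeasure μ] {U : Set Ω}
    (hU : MeasurableSet U) (T : Finset (Fin n)) :
    ∫ s : Fin n → Ω, ∑ k ∈ T, U.indicator (1 : Ω → ℝ) (s k) ∂(Measure.pi fun _ => μ) =
      T.card * μ.real U := by
  rw [integral_finsetSum]
  · rw [Finset.sum_congr rfl (g := fun _ => μ.real U), Finset.sum_const, nsmul_eq_mul]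
    exact fun k _ => integral_indicator_eval μ hU k
  · exact fun k _ => integrable_of_abs_le (B := 1)
      ((measurable_indicator_one hU).comp (measurable_pi_apply k)) fun s => by
        rw [abs_of_nonneg (indicator_one_nonneg _ _)]
        exact indicator_one_le_one _ _

theorem meanInvHits_nonneg (μ : Measure Ω) (U : Set Ω) (i j : Fin n) :
    0 ≤ meanInvHits μ U i j :=
  integral_nonneg fun _ => inv_nonneg.2 <| add_nonneg zero_le_two <|
    Finset.sum_nonneg fun _ _ => indicator_one_nonneg _ _

theorem pairWeight_nonneg (μ : Measure Ω) (U : Set Ω) (n : ℕ) : 0 ≤ pairWeight μ U n :=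
  Finset.sum_nonneg fun _ _ => Finset.sum_nonneg fun _ _ => meanInvHits_nonneg _ _ _ _

/-- The left side is the mean of a sum over ordered pairs of distinct hits, each weighted by the
reciprocal of the number `N` of hits. Restoring the diagonal bounds this sum by `N * N / N`, hence
by `N`, whose mean is the right side. The bound controls the smoothness error. -/
theorem pairWeight_mul_sq_le (μ : Measure Ω) [IsProbabilityMeasure μ] {U : Set Ω}
    (hU : MeasurableSet U) (n : ℕ) : pairWeight μ U n * μ.real U ^ 2 ≤ n * μ.real U := by
  have i1 := fun i j : Fin n => integrable_mul_div_hits μ hU hU hU subset_rfl i j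
  have e : pairWeight μ U n * μ.real U ^ 2 = ∫ s : Fin n → Ω, ∑ i, ∑ j ∈ Finset.univ.erase i,
      U.indicator (1 : Ω → ℝ) (s i) * U.indicator 1 (s j) / hits U s
      ∂(Measure.pi fun _ => μ) := by
    rw [integral_finsetSum _ fun i _ => integrable_finsetSum _ fun j _ => i1 i j,
      pairWeight, Finset.sum_mul]
    refine Finset.sum_congr rfl fun i _ => ?_
    rw [integral_finsetSum _ fun j _ => i1 i j, Finset.sum_mul]
    refine Finset.sum_congr rfl fun j hj => ?_
    rw [integral_mul_div_hits μ hU hU hU subset_rfl subset_rfl (Finset.ne_of_mem_erase hj), sq]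
  have e2 : ∫ s : Fin n → Ω, hits U s ∂(Measure.pi fun _ => μ) = n * μ.real U := by
    simpa [hits] using integral_hits μ hU (Finset.univ : Finset (Fin n))
  rw [e, ← e2]
  refine integral_mono (integrable_finsetSum _ fun i _ => integrable_finsetSum _ fun j _ =>
    i1 i j) (integrable_of_abs_le (measurable_hits hU) (B := n) fun s => ?_) fun s => ?_
  · rw [abs_of_nonneg (hits_nonneg _ _)]
    exact hits_le _ _
  · calc ∑ i, ∑ j ∈ Finset.univ.erase i,
          U.indicator (1 : Ω → ℝ) (s i) * U.indicator 1 (s j) / hits U s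
        ≤ ∑ i, ∑ j, U.indicator (1 : Ω → ℝ) (s i) * U.indicator 1 (s j) / hits U s :=
          Finset.sum_le_sum fun i _ => Finset.sum_le_sum_of_subset_of_nonneg
            (Finset.erase_subset _ _) fun _ _ _ => div_nonneg (mul_nonneg
              (indicator_one_nonneg _ _) (indicator_one_nonneg _ _)) (hits_nonneg _ _)
      _ = hits U s * hits U s / hits U s := by
          simp_rw [← Finset.sum_div, ← Finset.sum_mul_sum]
          rfl
      _ ≤ hits U s := (mul_self_div_self _).le

/-- Jensen's inequality for the reciprocal, proved by integrating its tangent line at `a = 2 + n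
μ(U)`. -/
theorem inv_le_meanInvHits (μ : Measure Ω) [IsProbabilityMeasure μ] {U : Set Ω}
    (hU : MeasurableSet U) (i j : Fin n) :
    (2 + n * μ.real U)⁻¹ ≤ meanInvHits μ U i j := by
  set T := (Finset.univ.erase i).erase j
  set a : ℝ := 2 + n * μ.real U with ha
  have hμ : 0 ≤ μ.real U := measureReal_nonneg
  have ha0 : 0 < a := by positivity
  have hm : Measurable fun s : Fin n → Ω => ∑ k ∈ T, U.indicator (1 : Ω → ℝ) (s k) :=
    Finset.measurable_sum _ fun k _ => (measurable_indicator_one hU).comp (measurable_pi_apply k)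
  have h0 : ∀ s : Fin n → Ω, 0 ≤ ∑ k ∈ T, U.indicator (1 : Ω → ℝ) (s k) := fun s =>
    Finset.sum_nonneg fun _ _ => indicator_one_nonneg _ _
  have hi : Integrable (fun s : Fin n → Ω => ∑ k ∈ T, U.indicator (1 : Ω → ℝ) (s k))
      (Measure.pi fun _ => μ) := integrable_of_abs_le hm (B := T.card) fun s => by
    rw [abs_of_nonneg (h0 s)]
    calc _ ≤ ∑ _k ∈ T, (1 : ℝ) := Finset.sum_le_sum fun _ _ => indicator_one_le_one _ _
      _ = _ := by simp
  have hint := integral_hits μ hU T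
  have hT : (T.card : ℝ) ≤ n := by
    exact_mod_cast (Finset.card_le_univ T).trans_eq (Fintype.card_fin n)
  -- The tangent to `y ↦ 1 / y` at `a` is `2 / a - y / a²`; it decreases in `y`, and the mean of `y`
  -- is at most `a`.
  calc a⁻¹ ≤ 2 / a - (2 + T.card * μ.real U) / a ^ 2 := by
        have : (2 + T.card * μ.real U) / a ^ 2 ≤ a / a ^ 2 := by gcongr; rw [ha]; gcongr
        have e : a / a ^ 2 = a⁻¹ := by field_simp
        have e' : 2 / a = 2 * a⁻¹ := by rw [div_eq_mul_inv]
        linarith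
    _ = ∫ s, (2 / a - 2 / a ^ 2 - (a ^ 2)⁻¹ * ∑ k ∈ T, U.indicator (1 : Ω → ℝ) (s k))
          ∂(Measure.pi fun _ => μ) := by
        rw [integral_sub (integrable_const _) (hi.const_mul _), integral_const_mul, hint]
        simp
        ring
    _ ≤ meanInvHits μ U i j := by
        refine integral_mono ((integrable_const _).sub (hi.const_mul _))
          (integrable_of_abs_le (measurable_const.add hm).inv (B := 1) fun s => ?_) fun s => ?_
        · have := h0 s
          rw [abs_of_nonneg (by positivity)]
          exact inv_le_one_of_one_le₀ (by linarith)
        · dsimp only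
          generalize hx : ∑ k ∈ T, U.indicator (1 : Ω → ℝ) (s k) = x
          have hx0 : 0 ≤ x := hx ▸ h0 s
          have e : (2 + x)⁻¹ - (2 / a - 2 / a ^ 2 - (a ^ 2)⁻¹ * x) =
              (a - (2 + x)) ^ 2 / ((2 + x) * a ^ 2) := by
            field_simp
            ring
          have : 0 ≤ (a - (2 + x)) ^ 2 / ((2 + x) * a ^ 2) := by positivity
          linarith

theorem div_le_pairWeight (μ : Measure Ω) [IsProbabilityMeasure μ] {U : Set Ω}
    (hU : MeasurableSet U) {n : ℕ} (hn : 1 ≤ n) :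
    n * (n - 1) / (2 + n * μ.real U) ≤ pairWeight μ U n := by
  calc (n * (n - 1) / (2 + n * μ.real U) : ℝ)
      = ∑ i : Fin n, ∑ j ∈ Finset.univ.erase i, (2 + n * μ.real U)⁻¹ := by
        simp [Finset.card_erase_of_mem, Nat.cast_sub hn, div_eq_mul_inv]
        ring
    _ ≤ _ := Finset.sum_le_sum fun i _ => Finset.sum_le_sum fun j _ => inv_le_meanInvHits μ hU i j

end Expectation

end MultiCMH

namespace MultiCMH

/-! ### Concentration and mean of the sum over strata -/

section Stratified
variable {Ω : Type*} {n T : ℕ}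

/-- Sum of the table deviations over the strata `U t`. -/
noncomputable def totalDev (U : Fin T → Set Ω) (A B : Set Ω) (s : Fin n → Ω) : ℝ :=
  ∑ t, tableDev (U t) A B s

theorem sum_indicator_le_one {U : Fin T → Set Ω} (hd : Pairwise fun t t' => Disjoint (U t) (U t'))
    (x : Ω) : ∑ t, (U t).indicator (1 : Ω → ℝ) x ≤ 1 := by
  by_cases h : ∃ t, x ∈ U t
  · obtain ⟨t, ht⟩ := h
    rw [Finset.sum_eq_single t]
    · exact indicator_one_le_one _ _
    · exact fun t' _ hne => Set.indicator_of_notMem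
        (fun h' => Set.disjoint_left.1 (hd hne) h' ht) _
    · simp
  · push Not at h
    simp [h]

theorem abs_tableDev_le (U A B : Set Ω) (s : Fin n → Ω) : |tableDev U A B s| ≤ n := by
  have h1 := hits_nonneg (U ∩ (A ∩ B)) s
  have h2 := hits_le (U ∩ (A ∩ B)) s
  have h3 := hits_nonneg (U ∩ A) s
  have h4 := hits_le (U ∩ A) s
  have h5 := hits_nonneg (U ∩ B) s
  have h6 := hits_mono (Set.inter_subset_left : U ∩ B ⊆ U) s
  have h7 : hits (U ∩ A) s * hits (U ∩ B) s / hits U s ≤ n := by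
    rw [mul_div_assoc]
    exact (mul_le_of_le_one_right h3 (div_le_one_of_le₀ h6 (h5.trans h6))).trans h4
  have h8 : 0 ≤ hits (U ∩ A) s * hits (U ∩ B) s / hits U s :=
    div_nonneg (mul_nonneg h3 h5) (h5.trans h6)
  rw [tableDev, abs_le]
  constructor <;> linarith

variable [MeasurableSpace Ω]

theorem measurable_totalDev {U : Fin T → Set Ω} {A B : Set Ω} (hU : ∀ t, MeasurableSet (U t))
    (hA : MeasurableSet A) (hB : MeasurableSet B) :
    Measurable fun s : Fin n → Ω => totalDev U A B s :=
  Finset.measurable_sum _ fun t _ => measurable_tableDev (hU t) hA hB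

/-- Chebyshev's inequality. By disjointness, the old and the new value of a replaced observation
each affect at most one stratum, so the differences are bounded by 2 uniformly in `T` and the
variance by `4 n`. -/
theorem measure_totalDev_lt_le (μ : Measure Ω) [IsProbabilityMeasure μ] {U : Fin T → Set Ω}
    {A B : Set Ω} (hU : ∀ t, MeasurableSet (U t)) (hA : MeasurableSet A) (hB : MeasurableSet B)
    (hd : Pairwise fun t t' => Disjoint (U t) (U t')) {r : ℝ} (hr : 0 < r) (a : ℝ)
    (ha : a + r ≤ ∫ s, totalDev U A B s ∂(Measure.pi fun _ : Fin n => μ)) :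
    (Measure.pi fun _ : Fin n => μ).real {s | totalDev U A B s < a} ≤ 4 * n / r ^ 2 := by
  set P := Measure.pi fun _ : Fin n => μ
  set E := ∫ s, totalDev U A B s ∂P
  have hm : Measurable fun s : Fin n → Ω => totalDev U A B s := measurable_totalDev hU hA hB
  have hbd : ∀ s : Fin n → Ω, |totalDev U A B s| ≤ T * n := fun s => by
    refine (Finset.abs_sum_le_sum_abs _ _).trans ?_
    calc _ ≤ ∑ _t : Fin T, (n : ℝ) := Finset.sum_le_sum fun _ _ => abs_tableDev_le _ _ _ _
      _ = _ := by simp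
  have hc : ∀ (s : Fin n → Ω) i x,
      |totalDev U A B (Function.update s i x) - totalDev U A B s| ≤ 2 := fun s i x => by
    rw [totalDev, totalDev, ← Finset.sum_sub_distrib]
    refine (Finset.abs_sum_le_sum_abs _ _).trans ?_
    calc _ ≤ ∑ t, ((U t).indicator (1 : Ω → ℝ) x + (U t).indicator 1 (s i)) :=
          Finset.sum_le_sum fun t _ => abs_tableDev_update_sub_le _ _ _ _ _ _
      _ ≤ 1 + 1 := by
          rw [Finset.sum_add_distrib]
          exact add_le_add (sum_indicator_le_one hd _) (sum_indicator_le_one hd _)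
      _ = 2 := by norm_num
  have hvar := integral_sq_sub_integral_le_of_bounded_differences μ n _ hm hbd hc
  have hsqm : Measurable fun s : Fin n → Ω => (totalDev U A B s - E) ^ 2 :=
    (hm.sub_const _).pow_const 2
  have hsqi : Integrable (fun s : Fin n → Ω => (totalDev U A B s - E) ^ 2) P := by
    refine integrable_of_abs_le hsqm (B := (T * n + |E|) ^ 2) fun s => ?_
    rw [abs_pow]
    exact pow_le_pow_left₀ (abs_nonneg _) ((abs_sub _ _).trans (by linarith [hbd s])) 2
  have hmk := mul_meas_ge_le_integral_of_nonneg (ae_of_all P fun s => sq_nonneg _) hsqi (r ^ 2)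
  rw [le_div_iff₀ (by positivity), mul_comm]
  refine le_trans ?_ (hmk.trans (hvar.trans_eq (by ring)))
  refine mul_le_mul_of_nonneg_left (measureReal_mono fun s hs => ?_) (by positivity)
  simp only [Set.mem_ofPred_eq] at hs ⊢
  have : r ≤ E - totalDev U A B s := by linarith
  nlinarith

/-- Lower bound of the mean deviation from lower bounds `p (c - δ p)` of the excess of the
`A ∩ B` probability in each stratum. -/
theorem le_integral_totalDev (μ : Measure Ω) [IsProbabilityMeasure μ] {U : Fin T → Set Ω}
    {A B : Set Ω} (hU : ∀ t, MeasurableSet (U t)) (hA : MeasurableSet A) (hB : MeasurableSet B)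
    (hd : Pairwise fun t t' => Disjoint (U t) (U t')) {c : Fin T → ℝ} (hc0 : ∀ t, 0 ≤ c t)
    (hc : ∀ t, c t ≤ μ.real (U t)) {δ : ℝ} (hδ : 0 ≤ δ)
    (hex : ∀ t, μ.real (U t) * c t - δ * μ.real (U t) ^ 2 ≤
      μ.real (U t ∩ (A ∩ B)) * μ.real (U t) - μ.real (U t ∩ A) * μ.real (U t ∩ B))
    (hn : 1 ≤ n) :
    n * (n - 1) * ((∑ t, c t) ^ 2 / (2 * T + n)) - δ * n ≤
      ∫ s, totalDev U A B s ∂(Measure.pi fun _ : Fin n => μ) := by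
  have hn1 : (1 : ℝ) ≤ n := by exact_mod_cast hn
  have hp : ∑ t, μ.real (U t) ≤ 1 := by
    rw [← measureReal_iUnion_fintype hd hU]
    exact measureReal_le_one
  have hp0 : ∀ t, 0 ≤ μ.real (U t) := fun t => measureReal_nonneg
  have hcs : ∑ t, c t ≤ 1 := (Finset.sum_le_sum fun t _ => hc t).trans hp
  -- Cauchy–Schwarz in Sedrakyan's form: the denominators add up to at most `2 T + n`, so having `T
  -- = O(n)` strata costs only a constant factor.
  have hsed := Finset.sq_sum_div_le_sum_sq_div Finset.univ c (g := fun t => 2 + n * c t)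
    fun t _ => by have := hc0 t; positivity
  have hden : ∑ t, (2 + n * c t) ≤ 2 * T + n := by
    rw [Finset.sum_add_distrib, ← Finset.mul_sum]
    simp only [Finset.sum_const, Finset.card_univ, Fintype.card_fin, nsmul_eq_mul]
    nlinarith
  have hmain : ∀ t, n * (n - 1) * (c t ^ 2 / (2 + n * c t)) - δ * (n * μ.real (U t)) ≤
      pairWeight μ (U t) n *
      (μ.real (U t ∩ (A ∩ B)) * μ.real (U t) - μ.real (U t ∩ A) * μ.real (U t ∩ B)) := fun t => by
    have h1 := mul_le_mul_of_nonneg_left (hex t) (pairWeight_nonneg μ (U t) n)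
    have h2 := mul_le_mul_of_nonneg_left (pairWeight_mul_sq_le μ (hU t) n) hδ
    have h3 := mul_le_mul_of_nonneg_right (div_le_pairWeight μ (hU t) hn)
      (mul_nonneg (hp0 t) (hc0 t))
    have hct := hc0 t
    have hpt := hp0 t
    -- Since `x / (2 + n x)` increases with `x`, the probability `p` may be replaced by the smaller
    -- `c t`.
    have h4 : c t ^ 2 / (2 + n * c t) ≤ μ.real (U t) * c t / (2 + n * μ.real (U t)) := by
      rw [div_le_div_iff₀ (by positivity) (by positivity)]
      have := mul_le_mul_of_nonneg_left (hc t) hct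
      nlinarith
    have h5 := mul_le_mul_of_nonneg_left h4 (show (0 : ℝ) ≤ n * (n - 1) by nlinarith)
    have h6 : (n * (n - 1) / (2 + n * μ.real (U t)) * (μ.real (U t) * c t) : ℝ) =
      n * (n - 1) * (μ.real (U t) * c t / (2 + n * μ.real (U t))) := by ring
    nlinarith
  have hint : ∫ s, totalDev U A B s ∂(Measure.pi fun _ : Fin n => μ) = ∑ t, pairWeight μ (U t) n *
      (μ.real (U t ∩ (A ∩ B)) * μ.real (U t) - μ.real (U t ∩ A) * μ.real (U t ∩ B)) := by
    simp only [totalDev]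
    rw [integral_finsetSum _ fun t _ => integrable_tableDev μ (hU t) hA hB]
    exact Finset.sum_congr rfl fun t _ => integral_tableDev μ (hU t) hA hB
  rw [hint]
  refine le_trans ?_ (Finset.sum_le_sum fun t _ => hmain t)
  rw [Finset.sum_sub_distrib, ← Finset.mul_sum, ← Finset.mul_sum, ← Finset.mul_sum]
  refine sub_le_sub (mul_le_mul_of_nonneg_left (le_trans ?_ hsed) (by nlinarith))
    (mul_le_mul_of_nonneg_left (mul_le_of_le_one_right (by positivity) hp) hδ)
  rcases Nat.eq_zero_or_pos T with rfl | hT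
  · simp
  · refine div_le_div_of_nonneg_left (sq_nonneg _) ?_ hden
    refine Finset.sum_pos (fun t _ => ?_) ⟨⟨0, hT⟩, Finset.mem_univ _⟩
    have := hc0 t
    positivity

end Stratified

/-! ### Conditional covariances of a binary pair -/

section Kernel
variable {α : Type*} [MeasurableSpace α]

/-- On a set where `f` and `g` are nearly constant, the product of integrals is nearly the integral
of the product. -/
theorem integral_mul_integral_le (π : Measure α) [IsFiniteMeasure π] {S : Set α}
    (hS : MeasurableSet S) {f g : α → ℝ} (hf : Measurable f) (hg : Measurable g)
    {δ : ℝ} (hδ : 0 ≤ δ) (hfb : ∀ z, |f z| ≤ 1) (hgb : ∀ z, |g z| ≤ 1)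
    (hfo : ∀ z ∈ S, ∀ z' ∈ S, |f z - f z'| ≤ δ) (hgo : ∀ z ∈ S, ∀ z' ∈ S, |g z - g z'| ≤ δ) :
    (∫ z in S, f z ∂π) * (∫ z in S, g z ∂π) ≤
      π.real S * (∫ z in S, f z * g z ∂π) + 2 * δ ^ 2 * π.real S ^ 2 := by
  rcases S.eq_empty_or_nonempty with rfl | ⟨z₀, h₀⟩
  · simp
  set m := π.real S
  have hm : 0 ≤ m := measureReal_nonneg
  have hfi : Integrable f (π.restrict S) := integrable_of_abs_le hf hfb
  have hgi : Integrable g (π.restrict S) := integrable_of_abs_le hg hgb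
  have hfgi : Integrable (fun z => f z * g z) (π.restrict S) :=
    integrable_of_abs_le (hf.mul hg) (B := 1) fun z => by
      rw [abs_mul]
      exact mul_le_one₀ (hfb z) (abs_nonneg _) (hgb z)
  have hb : ∀ (h : α → ℝ) (C : ℝ), (∀ z ∈ S, |h z| ≤ C) → |∫ z in S, h z ∂π| ≤ C * m :=
    fun h C hC =>
      norm_setIntegral_le_of_norm_le_const (f := h) (C := C) (measure_lt_top π S) hC
  have e1 : ∫ z in S, (f z - f z₀) ∂π = ∫ z in S, f z ∂π - m * f z₀ := by
    rw [integral_sub hfi (integrable_const _)]; simp [m]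
  have e2 : ∫ z in S, (g z - g z₀) ∂π = ∫ z in S, g z ∂π - m * g z₀ := by
    rw [integral_sub hgi (integrable_const _)]; simp [m]
  have e3 : ∫ z in S, (f z - f z₀) * (g z - g z₀) ∂π = ∫ z in S, f z * g z ∂π -
      g z₀ * ∫ z in S, f z ∂π - f z₀ * ∫ z in S, g z ∂π + m * (f z₀ * g z₀) := by
    have : ∀ z, (f z - f z₀) * (g z - g z₀) =
        f z * g z - g z₀ * f z - f z₀ * g z + f z₀ * g z₀ := fun z => by ring
    have i1 : Integrable (fun z => f z * g z - g z₀ * f z) (π.restrict S) :=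
      hfgi.sub (hfi.const_mul _)
    have i2 : Integrable (fun z => f z * g z - g z₀ * f z - f z₀ * g z) (π.restrict S) :=
      i1.sub (hgi.const_mul _)
    simp_rw [this]
    rw [integral_add i2 (integrable_const _), integral_sub i1 (hgi.const_mul _), integral_sub hfgi (hfi.const_mul _), integral_const_mul, integral_const_mul]
    simp [m]
  have b1 := hb _ δ fun z hz => hfo z hz z₀ h₀
  have b2 := hb _ δ fun z hz => hgo z hz z₀ h₀
  have b3 := hb (fun z => (f z - f z₀) * (g z - g z₀)) (δ ^ 2) fun z hz => by
    rw [abs_mul, sq]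
    exact mul_le_mul (hfo z hz z₀ h₀) (hgo z hz z₀ h₀) (abs_nonneg _) hδ
  have b4 : (∫ z in S, (f z - f z₀) ∂π) * (∫ z in S, (g z - g z₀) ∂π) ≤ (δ * m) * (δ * m) := by
    refine (le_abs_self _).trans ?_
    rw [abs_mul]
    exact mul_le_mul b1 b2 (abs_nonneg _) (by positivity)
  have b5 : -(m * ∫ z in S, (f z - f z₀) * (g z - g z₀) ∂π) ≤ m * (δ ^ 2 * m) := by
    rw [← mul_neg]
    exact mul_le_mul_of_nonneg_left ((neg_le_abs _).trans b3) hm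
  -- The covariance is unchanged when `f` and `g` are centred at `z₀`; the centred functions are at
  -- most `δ` on `S`, and each of the two terms contributes at most `δ² m²`.
  have e4 : (∫ z in S, f z ∂π) * (∫ z in S, g z ∂π) - m * ∫ z in S, f z * g z ∂π =
      (∫ z in S, (f z - f z₀) ∂π) * (∫ z in S, (g z - g z₀) ∂π) -
        m * ∫ z in S, (f z - f z₀) * (g z - g z₀) ∂π := by
    rw [e1, e2, e3]; ring
  linarith

/-- Covariance of a binary pair. -/
noncomputable def pairCov (ν : Measure (Bool × Bool)) : ℝ :=
  ν.real {(true, true)} - ν.real {x | x.1 = true} * ν.real {x | x.2 = true}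

/-- Since the four cells sum to one, the covariance is the determinant of the table, whose sign is
that of the log odds ratio. -/
theorem pairCov_eq (ν : Measure (Bool × Bool)) [IsProbabilityMeasure ν] :
    pairCov ν = ν.real {(false, false)} * ν.real {(true, true)} -
      ν.real {(false, true)} * ν.real {(true, false)} := by
  have h := fun s : Finset (Bool × Bool) => sum_measureReal_singleton (μ := ν) s
  have h1 := h Finset.univ
  have e1 := h {(true, true), (true, false)}
  have e2 := h {(true, true), (false, true)}
  have s1 : {x : Bool × Bool | x.1 = true} = (({(true, true), (true, false)} : Finset _) : Set _) := by
    ext ⟨a, b⟩; cases a <;> cases b <;> simp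
  have s2 : {x : Bool × Bool | x.2 = true} = (({(true, true), (false, true)} : Finset _) : Set _) := by
    ext ⟨a, b⟩; cases a <;> cases b <;> simp
  rw [pairCov, s1, s2, ← e1, ← e2]
  rw [Finset.coe_univ, probReal_univ, Fintype.sum_prod_type] at h1
  simp only [Fintype.sum_bool] at h1
  rw [Finset.sum_pair (by simp), Finset.sum_pair (by simp)]
  have h2 : ν.real {(false, false)} = 1 - ν.real {(true, true)} - ν.real {(true, false)} -
    ν.real {(false, true)} := by linarith
  rw [h2]; ring

theorem abs_pairCov_le_one (ν : Measure (Bool × Bool)) [IsProbabilityMeasure ν] :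
    |pairCov ν| ≤ 1 := by
  have h := fun s : Set (Bool × Bool) => measureReal_le_one (μ := ν) (s := s)
  have h0 := fun s : Set (Bool × Bool) => measureReal_nonneg (μ := ν) (s := s)
  rw [pairCov, abs_le]
  constructor
  · have := mul_le_one₀ (h {x | x.1 = true}) (h0 _) (h {x | x.2 = true})
    linarith [h0 {(true, true)}]
  · have := mul_nonneg (h0 {x | x.1 = true}) (h0 {x | x.2 = true})
    linarith [h {(true, true)}]

/-- The two bounds on `a / b` exclude `a = 0` and `b = 0`, the cases in which division in `ℝ≥0∞`
would not reflect the order of `a` and `b`. -/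
theorem one_lt_div_or {a b : ℝ≥0∞} (h : 1 ≤ a / b) (h' : a / b < ⊤) (ha : a ≠ ⊤) (hb : b ≠ ⊤) :
    b ≤ a ∧ (1 < a / b → b < a) := by
  have ha0 : a ≠ 0 := by rintro rfl; simp at h
  have hb0 : b ≠ 0 := by rintro rfl; simp [ENNReal.div_zero ha0] at h'
  refine ⟨?_, fun h1 => ?_⟩
  · simpa using (ENNReal.le_div_iff_mul_le (Or.inl hb0) (Or.inl hb)).1 h
  · simpa using (ENNReal.lt_div_iff_mul_lt (Or.inl hb0) (Or.inl hb)).1 h1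

theorem pairCov_nonneg {d : ℕ} {κ : BinKernel d} [IsMarkovKernel κ] {z : EuclideanSpace ℝ (Fin d)}
    (h : 0 ≤ logOddsRatio κ z) (h' : logOddsRatio κ z < ⊤) :
    0 ≤ pairCov (κ z) ∧ (0 < logOddsRatio κ z → 0 < pairCov (κ z)) := by
  rw [logOddsRatio, ENNReal.zero_le_log_iff] at h
  rw [logOddsRatio, ENNReal.log_lt_top_iff] at h'
  rw [logOddsRatio, ENNReal.zero_lt_log_iff, pairCov_eq]
  have hb : κ z {(false, true)} * κ z {(true, false)} ≠ ⊤ := by finiteness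
  have ha : κ z {(false, false)} * κ z {(true, true)} ≠ ⊤ := by finiteness
  obtain ⟨h1, h2⟩ := one_lt_div_or h h' ha hb
  simp only [Measure.real, ← ENNReal.toReal_mul, sub_nonneg, sub_pos]
  exact ⟨ENNReal.toReal_mono ha h1, fun hlt => (ENNReal.toReal_lt_toReal hb ha).2 (h2 hlt)⟩

/-- A difference factors as `(√p - √q) (√p + √q)`; the factors are at most twice the Hellinger
distance (`√2` rounded up) and 2. -/
theorem abs_sub_le_hellinger {A : Type} [Fintype A] [MeasurableSpace A] (μ ν : Measure A)
    [IsProbabilityMeasure μ] [IsProbabilityMeasure ν] (a : A) :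
    |μ.real {a} - ν.real {a}| ≤ 4 * hellinger μ ν := by
  have h1 : |√(μ.real {a}) - √(ν.real {a})| ≤ 2 * hellinger μ ν := by
    rw [hellinger]
    refine Real.abs_le_sqrt (y := 4 * (1 / 2 * ∑ a, (√(μ.real {a}) - √(ν.real {a})) ^ 2)) ?_
      |>.trans_eq ?_
    · have := Finset.single_le_sum (f := fun a => (√(μ.real {a}) - √(ν.real {a})) ^ 2)
        (fun _ _ => sq_nonneg _) (Finset.mem_univ a)
      have h0 : 0 ≤ ∑ a, (√(μ.real {a}) - √(ν.real {a})) ^ 2 :=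
        Finset.sum_nonneg fun _ _ => sq_nonneg _
      linarith
    · rw [Real.sqrt_mul (by norm_num), show (4 : ℝ) = 2 ^ 2 by norm_num,
        Real.sqrt_sq (by norm_num)]
  have h2 : |√(μ.real {a}) + √(ν.real {a})| ≤ 2 := by
    rw [abs_of_nonneg (by positivity)]
    have := Real.sqrt_le_one.2 (measureReal_le_one (μ := μ) (s := {a}))
    have := Real.sqrt_le_one.2 (measureReal_le_one (μ := ν) (s := {a}))
    linarith
  have e : μ.real {a} - ν.real {a} =
      (√(μ.real {a}) - √(ν.real {a})) * (√(μ.real {a}) + √(ν.real {a})) := by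
    have := Real.sq_sqrt (measureReal_nonneg (μ := μ) (s := {a}))
    have := Real.sq_sqrt (measureReal_nonneg (μ := ν) (s := {a}))
    nlinarith
  rw [e, abs_mul]
  calc _ ≤ (2 * hellinger μ ν) * 2 := mul_le_mul h1 h2 (abs_nonneg _)
        (mul_nonneg zero_le_two (Real.sqrt_nonneg _))
    _ = _ := by ring

/-- Both smoothness conditions make the two marginal conditional probabilities Lipschitz. -/
theorem exists_lipschitz_marginals {d : ℕ} {𝒵 : Set (EuclideanSpace ℝ (Fin d))} {κ : BinKernel d}
    [IsMarkovKernel κ] (h : JointlySmooth 𝒵 κ ∨ MarginallySmooth 𝒵 κ) :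
    ∃ K : ℝ, 0 ≤ K ∧ ∀ z ∈ 𝒵, ∀ z' ∈ 𝒵,
      |(κ z).real {x | x.1 = true} - (κ z').real {x | x.1 = true}| ≤ K * dist z z' ∧
      |(κ z).real {x | x.2 = true} - (κ z').real {x | x.2 = true}| ≤ K * dist z z' := by
  rcases h with ⟨L, hL, h⟩ | ⟨L, hL, h⟩
  -- A marginal probability is a sum of two cells, each with Lipschitz constant `4 L`.
  · refine ⟨8 * L, by positivity, fun z hz z' hz' => ?_⟩
    have hh := h z hz z' hz'
    have key := fun a => (abs_sub_le_hellinger (κ z) (κ z') a).trans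
      (mul_le_mul_of_nonneg_left hh (by norm_num))
    have s1 : {x : Bool × Bool | x.1 = true} = (({(true, true), (true, false)} : Finset _) : Set _) := by
      ext ⟨a, b⟩; cases a <;> cases b <;> simp
    have s2 : {x : Bool × Bool | x.2 = true} = (({(true, true), (false, true)} : Finset _) : Set _) := by
      ext ⟨a, b⟩; cases a <;> cases b <;> simp
    rw [s1, s2]
    simp only [← sum_measureReal_singleton]
    rw [Finset.sum_pair (by simp), Finset.sum_pair (by simp), Finset.sum_pair (by simp),
      Finset.sum_pair (by simp)]
    have k1 := abs_le.1 (key (true, true))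
    have k2 := abs_le.1 (key (true, false))
    have k3 := abs_le.1 (key (false, true))
    rw [abs_le, abs_le]
    refine ⟨⟨?_, ?_⟩, ?_, ?_⟩ <;> linarith [k1.1, k1.2, k2.1, k2.2, k3.1, k3.2]
  · refine ⟨4 * L, by positivity, fun z hz z' hz' => ?_⟩
    have hh := h z hz z' hz'
    have := fun z => Measure.isProbabilityMeasure_map (μ := κ z) measurable_fst.aemeasurable
    have := fun z => Measure.isProbabilityMeasure_map (μ := κ z) measurable_snd.aemeasurable
    have k1 := (abs_sub_le_hellinger ((κ z).map Prod.fst) ((κ z').map Prod.fst) true).trans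
      (mul_le_mul_of_nonneg_left ((le_max_left _ _).trans hh) (by norm_num))
    have k2 := (abs_sub_le_hellinger ((κ z).map Prod.snd) ((κ z').map Prod.snd) true).trans
      (mul_le_mul_of_nonneg_left ((le_max_right _ _).trans hh) (by norm_num))
    rw [map_measureReal_apply measurable_fst (measurableSet_singleton _),
      map_measureReal_apply measurable_fst (measurableSet_singleton _), ← mul_assoc] at k1
    rw [map_measureReal_apply measurable_snd (measurableSet_singleton _),
      map_measureReal_apply measurable_snd (measurableSet_singleton _), ← mul_assoc] at k2
    exact ⟨k1, k2⟩

end Kernel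

end MultiCMH

namespace MultiCMH

/-! ### Dyadic nodes and the mean of the numerator in a signal window -/

theorem measurableSet_node (l i : ℕ) : MeasurableSet (node l i) := measurableSet_Ioc

theorem nodeLeft_subset (l i : ℕ) : nodeLeft l i ⊆ node l i := by
  obtain ⟨h1, h2, -⟩ := node_children l i _ _ rfl rfl
  rw [h1, h2]
  have : (i : ℝ) / 2 ^ l ≤ ((i : ℝ) + 1) / 2 ^ l := by gcongr; linarith
  exact Set.Ioc_subset_Ioc_right (by linarith)

theorem nodeRight_eq_diff (l i : ℕ) : nodeRight l i = node l i \ nodeLeft l i := by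
  obtain ⟨h1, h2, h3⟩ := node_children l i _ _ rfl rfl
  rw [h1, h2, h3]
  have : (i : ℝ) / 2 ^ l ≤ ((i : ℝ) + 1) / 2 ^ l := by gcongr; linarith
  ext x
  simp only [Set.mem_Ioc, Set.mem_sdiff, not_and, not_le]
  constructor
  · rintro ⟨ha, hb⟩
    exact ⟨⟨by linarith, hb⟩, fun _ => ha⟩
  · rintro ⟨⟨ha, hb⟩, hc⟩
    exact ⟨hc ha, hb⟩

section Signal
variable {d : ℕ} {𝒵 : Set (EuclideanSpace ℝ (Fin d))}

/-- The observations in the window `w` with `z ∈ C`. -/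
def slab (w : Window) (C : Set (EuclideanSpace ℝ (Fin d))) : Set (Obs d) := w.I ×ˢ w.J ×ˢ C

/-- The observations with `x ∈ I^left`. -/
def leftX (w : Window) : Set (Obs d) := {o | o.1 ∈ w.ILeft}

/-- The observations with `y ∈ J^left`. -/
def leftY (w : Window) : Set (Obs d) := {o | o.2.1 ∈ w.JLeft}

theorem measurableSet_slab (w : Window) {C : Set (EuclideanSpace ℝ (Fin d))}
    (hC : MeasurableSet C) : MeasurableSet (slab w C) :=
  (measurableSet_node _ _).prod ((measurableSet_node _ _).prod hC)

theorem measurableSet_leftX (w : Window) : MeasurableSet (leftX (d := d) w) :=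
  measurable_fst (measurableSet_node _ _)

theorem measurableSet_leftY (w : Window) : MeasurableSet (leftY (d := d) w) :=
  (measurable_fst.comp measurable_snd) (measurableSet_node _ _)

theorem pairwise_disjoint_slab (w : Window) (S : Stratification 𝒵) :
    Pairwise fun t t' => Disjoint (slab w (S.cell t)) (slab w (S.cell t')) := fun _ _ h =>
  Set.disjoint_left.2 fun _ ho ho' => Set.disjoint_left.1 (S.disjoint_cell h) ho.2.2 ho'.2.2

open Classical in
/-- The triple of `z` and the indicators of `x ∈ I^left` and `y ∈ J^left`. -/
noncomputable def binarize (w : Window) (o : Obs d) :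
    EuclideanSpace ℝ (Fin d) × (Bool × Bool) :=
  (o.2.2, decide (o.1 ∈ w.ILeft), decide (o.2.1 ∈ w.JLeft))

theorem inducedTriple_eq_map (Q : Measure (Obs d)) (w : Window) :
    inducedTriple 𝒵 Q w = (cond Q (slab w 𝒵)).map (binarize w) := rfl

theorem measurable_binarize (w : Window) : Measurable (binarize (d := d) w) := by
  refine (measurable_snd.comp measurable_snd).prodMk (Measurable.prodMk ?_ ?_)
  · refine measurable_to_bool ?_
    convert measurableSet_leftX (d := d) w using 1
    ext o
    simp [leftX]
  · refine measurable_to_bool ?_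
    convert measurableSet_leftY (d := d) w using 1
    ext o
    simp [leftY]

/-- Probabilities under `Q` of events in the window in terms of the law of the binary triple. -/
theorem measureReal_slab_inter (h𝒵 : MeasurableSet 𝒵) (Q : Measure (Obs d))
    [IsProbabilityMeasure Q] (w : Window) {κ : BinKernel d} [IsMarkovKernel κ]
    [IsFiniteMeasure (inducedTriple 𝒵 Q w)]
    (hκ : (inducedTriple 𝒵 Q w).IsCondKernel κ) (hq : Q (slab w 𝒵) ≠ 0)
    {C : Set (EuclideanSpace ℝ (Fin d))} (hC : MeasurableSet C) (hC𝒵 : C ⊆ 𝒵)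
    (E : Set (Bool × Bool)) (F : Set (Obs d))
    (hF : ∀ o : Obs d, o ∈ F ↔ (binarize w o).2 ∈ E) :
    Q.real (slab w C ∩ F) =
      Q.real (slab w 𝒵) * ∫ z in C, (κ z).real E ∂(inducedTriple 𝒵 Q w).fst := by
  have hE : MeasurableSet E := E.toFinite.measurableSet
  have h1 : ∫ z in C, (κ z).real E ∂(inducedTriple 𝒵 Q w).fst =
      (inducedTriple 𝒵 Q w).real (C ×ˢ E) := by
    conv_rhs => rw [Measure.real, ← hκ.disintegrate]
    rw [Measure.compProd_apply_prod hC hE]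
    exact integral_toReal (Kernel.measurable_coe κ hE).aemeasurable
      (ae_of_all _ fun z => measure_lt_top _ _)
  have h2 : (inducedTriple 𝒵 Q w).real (C ×ˢ E) =
      (Q.real (slab w 𝒵))⁻¹ * Q.real (slab w C ∩ F) := by
    rw [Measure.real, inducedTriple_eq_map, Measure.map_apply (measurable_binarize w) (hC.prod hE),
      cond_apply (measurableSet_slab w h𝒵), ENNReal.toReal_mul, ENNReal.toReal_inv]
    refine congrArg (fun G => (Q (slab w 𝒵)).toReal⁻¹ * (Q G).toReal) (Set.ext fun o => ?_)
    rw [Set.mem_inter_iff, Set.mem_inter_iff, hF]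
    exact ⟨fun ⟨⟨a, b, _⟩, c, e⟩ => ⟨⟨a, b, c⟩, e⟩, fun ⟨⟨a, b, c⟩, e⟩ => ⟨⟨a, b, hC𝒵 c⟩, c, e⟩⟩
  have hq' : Q.real (slab w 𝒵) ≠ 0 := by simpa [Measure.real, ENNReal.toReal_eq_zero_iff] using hq
  rw [h1, h2, mul_inv_cancel_left₀ hq']

theorem tendsto_mesh {S : ℕ → Stratification 𝒵}
    (h : Tendsto (fun n : ℕ => (S n).mesh * ENNReal.ofReal (√n)) atTop (𝓝 0)) :
    Tendsto (fun n => (S n).mesh) atTop (𝓝 0) := by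
  refine tendsto_of_tendsto_of_tendsto_of_le_of_le' tendsto_const_nhds h
    (Eventually.of_forall fun _ => zero_le) ?_
  filter_upwards [eventually_ge_atTop 1] with n hn
  refine le_mul_of_one_le_right (zero_le) (ENNReal.one_le_ofReal.2 (Real.one_le_sqrt.2 ?_))
  exact_mod_cast hn

theorem dist_le_mesh (S : Stratification 𝒵) (hS : S.mesh ≠ ⊤) {t : Fin S.T}
    {z z' : EuclideanSpace ℝ (Fin d)} (hz : z ∈ S.cell t) (hz' : z' ∈ S.cell t) :
    dist z z' ≤ S.mesh.toReal := by
  rw [dist_edist]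
  exact ENNReal.toReal_mono hS ((Metric.edist_le_ediam_of_mem hz hz').trans
    (le_iSup (fun t => Metric.ediam (S.cell t)) t))

/-- In a signal window the mean of the numerator of the statistic is at least linear in `n`. -/
theorem exists_linear_le_integral_totalDev (h𝒵 : MeasurableSet 𝒵) (Q : Measure (Obs d))
    [IsProbabilityMeasure Q] (w : Window) (S : ℕ → Stratification 𝒵)
    (h : SignalWindow 𝒵 Q w S) : ∃ c : ℝ, 0 < c ∧ ∀ᶠ n : ℕ in atTop, c * n ≤
      ∫ s, totalDev (fun t => slab w ((S n).cell t)) (leftX w) (leftY w) s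
        ∂(Measure.pi fun _ : Fin n => Q) := by
  obtain ⟨⟨κ, hmk, hκ, -, hlog, hpos, hsm⟩, hT, hmesh⟩ := h
  set ρ := inducedTriple 𝒵 Q w with hρ
  -- Conditioning on a null event gives the zero measure, which would contradict the positive mass
  -- of the set of positive log odds ratios.
  have hq : Q (slab w 𝒵) ≠ 0 := fun h0 => by
    have : ρ = 0 := by
      rw [hρ, inducedTriple_eq_map, cond_eq_zero_of_meas_eq_zero h0, Measure.map_zero]
    simp [this] at hpos
  have hpc : IsProbabilityMeasure (cond Q (slab w 𝒵)) := cond_isProbabilityMeasure hq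
  have hpρ : IsProbabilityMeasure ((cond Q (slab w 𝒵)).map (binarize w)) := Measure.isProbabilityMeasure_map
    (measurable_binarize w).aemeasurable
  rw [← inducedTriple_eq_map, ← hρ] at hpρ
  set π := ρ.fst
  set q := Q.real (slab w 𝒵) with hqdef
  have hq0 : 0 < q := ENNReal.toReal_pos hq (measure_ne_top _ _)
  obtain ⟨K, hK, hLip⟩ := exists_lipschitz_marginals
    (hsm.imp_right And.left : JointlySmooth 𝒵 κ ∨ MarginallySmooth 𝒵 κ)
  have hfm : ∀ E : Set (Bool × Bool), Measurable fun z => (κ z).real E := fun E =>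
    (Kernel.measurable_coe κ E.toFinite.measurableSet).ennreal_toReal
  have hfb : ∀ (E : Set (Bool × Bool)) z, |(κ z).real E| ≤ 1 := fun E z => by
    rw [abs_of_nonneg measureReal_nonneg]
    exact measureReal_le_one
  have hcm : Measurable fun z => pairCov (κ z) := (hfm _).sub ((hfm _).mul (hfm _))
  have hci : Integrable (fun z => pairCov (κ z)) π :=
    integrable_of_abs_le hcm fun z => abs_pairCov_le_one (κ z)
  have hc0 : ∀ z ∈ 𝒵, 0 ≤ pairCov (κ z) := fun z hz =>
    (pairCov_nonneg (hlog z hz).1 (hlog z hz).2).1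
  -- Total signal: the mean conditional covariance, scaled by the window probability. It does not
  -- depend on the stratification.
  set c₀ := q * ∫ z in 𝒵, pairCov (κ z) ∂π with hc₀
  have hc₀pos : 0 < c₀ := by
    refine mul_pos hq0 ((setIntegral_pos_iff_support_of_nonneg_ae
      ((ae_restrict_iff' h𝒵).2 (ae_of_all _ hc0)) hci.integrableOn).2 (hpos.trans_le ?_))
    refine measure_mono fun z hz => ⟨?_, hz.1⟩
    exact ((pairCov_nonneg (hlog z hz.1).1 (hlog z hz.1).2).2 hz.2).ne'
  obtain ⟨K', hK', hT'⟩ := hT.1.exists_pos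
  -- With `T ≤ K' n` the main term is at least `4 c (n - 1)`. The smoothness error is eventually at
  -- most `c n`, and `4 c (n - 1) - c n ≥ c n` for `n ≥ 2`.
  set c := c₀ ^ 2 / (2 * K' + 1) / 4 with hc
  have hcpos : 0 < c := by positivity
  refine ⟨c, hcpos, ?_⟩
  have hδ : Tendsto (fun n => 2 * (K * (S n).mesh.toReal) ^ 2) atTop (𝓝 0) := by
    have h1 := (ENNReal.tendsto_toReal ENNReal.zero_ne_top).comp (tendsto_mesh hmesh)
    simpa using ((h1.const_mul K).pow 2).const_mul 2
  filter_upwards [hT'.bound, hδ.eventually_le_const hcpos,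
    (tendsto_mesh hmesh).eventually_lt_const (ENNReal.zero_lt_top), eventually_ge_atTop 2]
    with n hTn hδn hfin hn
  have hn2 : (2 : ℝ) ≤ n := by exact_mod_cast hn
  simp only [Real.norm_natCast] at hTn
  set δ := K * (S n).mesh.toReal with hδdef
  have hδ0 : 0 ≤ δ := by positivity
  have hcell : ∀ t, (S n).cell t ⊆ 𝒵 := fun t =>
    (Set.subset_iUnion _ t).trans_eq (S n).iUnion_cell
  have hcells := (S n).measurable_cell
  have hslab : ∀ t (E : Set (Bool × Bool)) (F : Set (Obs d)),
      (∀ o : Obs d, o ∈ F ↔ (binarize w o).2 ∈ E) →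
      Q.real (slab w ((S n).cell t) ∩ F) = q * ∫ z in (S n).cell t, (κ z).real E ∂π :=
    fun t E F hF => measureReal_slab_inter h𝒵 Q w hκ hq (hcells t) (hcell t) E F hF
  have e0 : ∀ t, Q.real (slab w ((S n).cell t)) = q * π.real ((S n).cell t) := fun t => by
    have := hslab t Set.univ Set.univ (by simp)
    simpa using this
  have e1 := fun t => hslab t {x | x.1 = true} (leftX w) (by simp [leftX, binarize])
  have e2 := fun t => hslab t {x | x.2 = true} (leftY w) (by simp [leftY, binarize])
  have e3 := fun t => hslab t {(true, true)} (leftX w ∩ leftY w) (by simp [leftX, leftY, binarize])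
  have hmain := le_integral_totalDev Q (n := n) (U := fun t => slab w ((S n).cell t))
    (A := leftX w) (B := leftY w) (fun t => measurableSet_slab w (hcells t))
    (measurableSet_leftX w) (measurableSet_leftY w) (pairwise_disjoint_slab w (S n))
    (c := fun t => q * ∫ z in (S n).cell t, pairCov (κ z) ∂π) (δ := 2 * δ ^ 2)
    (fun t => mul_nonneg hq0.le
      (setIntegral_nonneg (hcells t) fun z hz => hc0 z (hcell t hz)))
    (fun t => by
      rw [e0]
      refine mul_le_mul_of_nonneg_left ?_ hq0.le
      calc ∫ z in (S n).cell t, pairCov (κ z) ∂π ≤ ∫ _ in (S n).cell t, (1 : ℝ) ∂π :=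
            integral_mono hci.integrableOn (integrable_const _) fun z =>
              (abs_le.1 (abs_pairCov_le_one (κ z))).2
        _ = π.real ((S n).cell t) := by simp)
    (by positivity)
    (fun t => by
      -- Law of total covariance within the cell: the conditional marginals oscillate by at most
      -- `δ`, so their covariance lowers the excess by at most `2 δ²` times the squared slab
      -- probability.
      have hosc := integral_mul_integral_le π (hcells t) (hfm {x | x.1 = true})
        (hfm {x | x.2 = true}) hδ0 (hfb _) (hfb _)
        (fun z hz z' hz' => (hLip z (hcell t hz) z' (hcell t hz')).1.trans
          (mul_le_mul_of_nonneg_left (dist_le_mesh (S n) hfin.ne hz hz') hK))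
        (fun z hz z' hz' => (hLip z (hcell t hz) z' (hcell t hz')).2.trans
          (mul_le_mul_of_nonneg_left (dist_le_mesh (S n) hfin.ne hz hz') hK))
      have hcov : ∫ z in (S n).cell t, pairCov (κ z) ∂π =
          ∫ z in (S n).cell t, (κ z).real {(true, true)} ∂π -
          ∫ z in (S n).cell t, (κ z).real {x | x.1 = true} * (κ z).real {x | x.2 = true} ∂π := by
        refine integral_sub (integrable_of_abs_le (hfm _) (hfb _))
          (integrable_of_abs_le ((hfm _).mul (hfm _)) (B := 1) fun z => ?_)
        rw [abs_mul]
        exact mul_le_one₀ (hfb _ z) (abs_nonneg _) (hfb _ z)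
      rw [e0, e1, e2, e3, hcov]
      have := mul_le_mul_of_nonneg_left hosc (sq_nonneg q)
      nlinarith)
    (by omega)
  refine le_trans ?_ hmain
  have hsum : ∑ t, q * ∫ z in (S n).cell t, pairCov (κ z) ∂π = c₀ := by
    rw [← Finset.mul_sum, hc₀]
    congr 1
    conv_rhs => rw [← (S n).iUnion_cell]
    rw [integral_iUnion_fintype hcells (S n).disjoint_cell fun t => hci.integrableOn]
  rw [hsum]
  have h1 : c₀ ^ 2 / ((2 * K' + 1) * n) ≤ c₀ ^ 2 / (2 * (S n).T + n) := by
    have : (0 : ℝ) ≤ (S n).T := Nat.cast_nonneg _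
    refine div_le_div_of_nonneg_left (sq_nonneg _) (by positivity) ?_
    nlinarith
  have h2 : (n * (n - 1) * (c₀ ^ 2 / ((2 * K' + 1) * n)) : ℝ) = 4 * c * (n - 1) := by
    rw [hc]; field_simp
  have h3 := mul_le_mul_of_nonneg_left h1 (show (0 : ℝ) ≤ n * (n - 1) by nlinarith)
  rw [h2] at h3
  have h4 : 2 * δ ^ 2 * n ≤ c * n := mul_le_mul_of_nonneg_right hδn (by positivity)
  nlinarith

end Signal

end MultiCMH

namespace MultiCMH

/-! ### The statistic of a window in terms of table deviations -/

section Deterministic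
variable {d n : ℕ} {𝒵 : Set (EuclideanSpace ℝ (Fin d))}

theorem count_eq_hits (s : Fin n → Obs d) (A B : Set ℝ) (C : Set (EuclideanSpace ℝ (Fin d))) :
    (count s A B C : ℝ) = hits (A ×ˢ B ×ˢ C) s := by
  classical
  simp only [count, Finset.card_filter, hits, Set.indicator_apply, Nat.cast_sum, Nat.cast_ite,
    Nat.cast_one, Nat.cast_zero, Pi.one_apply, Set.mem_prod]

theorem count_window (s : Fin n → Obs d) (w : Window) (C : Set (EuclideanSpace ℝ (Fin d))) :
    (count s w.I w.J C : ℝ) = hits (slab w C) s := count_eq_hits s _ _ _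

theorem count_left_window (s : Fin n → Obs d) (w : Window) (C : Set (EuclideanSpace ℝ (Fin d))) :
    (count s w.ILeft w.J C : ℝ) = hits (slab w C ∩ leftX w) s := by
  rw [count_eq_hits]
  congr 1
  ext o
  have := @nodeLeft_subset w.l₁ w.i o.1
  simp only [slab, leftX, Set.mem_inter_iff, Set.mem_prod, Set.mem_ofPred_eq, Window.I,
    Window.ILeft] at this ⊢
  tauto

theorem count_window_left (s : Fin n → Obs d) (w : Window) (C : Set (EuclideanSpace ℝ (Fin d))) :
    (count s w.I w.JLeft C : ℝ) = hits (slab w C ∩ leftY w) s := by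
  rw [count_eq_hits]
  congr 1
  ext o
  have := @nodeLeft_subset w.l₂ w.j o.2.1
  simp only [slab, leftY, Set.mem_inter_iff, Set.mem_prod, Set.mem_ofPred_eq, Window.J,
    Window.JLeft] at this ⊢
  tauto

theorem count_left_left (s : Fin n → Obs d) (w : Window) (C : Set (EuclideanSpace ℝ (Fin d))) :
    (count s w.ILeft w.JLeft C : ℝ) = hits (slab w C ∩ (leftX w ∩ leftY w)) s := by
  rw [count_eq_hits]
  congr 1
  ext o
  have h1 := @nodeLeft_subset w.l₁ w.i o.1
  have h2 := @nodeLeft_subset w.l₂ w.j o.2.1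
  simp only [slab, leftX, leftY, Set.mem_inter_iff, Set.mem_prod, Set.mem_ofPred_eq, Window.I,
    Window.ILeft, Window.J, Window.JLeft] at h1 h2 ⊢
  tauto

theorem hits_add_hits_diff (s : Fin n → Obs d) (E F : Set (Obs d)) :
    hits (E ∩ F) s + hits (E \ F) s = hits E s := by
  simp only [hits, ← Finset.sum_add_distrib]
  refine Finset.sum_congr rfl fun i _ => ?_
  by_cases hE : s i ∈ E <;> by_cases hF : s i ∈ F <;> simp [hE, hF]

theorem count_left_add_right (s : Fin n → Obs d) (w : Window)
    (C : Set (EuclideanSpace ℝ (Fin d))) :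
    count s w.ILeft w.J C + count s w.IRight w.J C = count s w.I w.J C := by
  have h : (count s w.IRight w.J C : ℝ) = hits (slab w C \ leftX w) s := by
    rw [count_eq_hits]
    congr 1
    ext o
    simp only [slab, leftX, Set.mem_sdiff, Set.mem_prod, Set.mem_ofPred_eq, Window.I,
      Window.ILeft, Window.IRight, nodeRight_eq_diff]
    tauto
  exact_mod_cast (show (count s w.ILeft w.J C + count s w.IRight w.J C : ℝ) =
    count s w.I w.J C by rw [h, count_left_window, count_window, hits_add_hits_diff])

theorem count_add_left_right (s : Fin n → Obs d) (w : Window)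
    (C : Set (EuclideanSpace ℝ (Fin d))) :
    count s w.I w.JLeft C + count s w.I w.JRight C = count s w.I w.J C := by
  have h : (count s w.I w.JRight C : ℝ) = hits (slab w C \ leftY w) s := by
    rw [count_eq_hits]
    congr 1
    ext o
    simp only [slab, leftY, Set.mem_sdiff, Set.mem_prod, Set.mem_ofPred_eq, Window.J,
      Window.JLeft, Window.JRight, nodeRight_eq_diff]
    tauto
  exact_mod_cast (show (count s w.I w.JLeft C + count s w.I w.JRight C : ℝ) =
    count s w.I w.J C by rw [h, count_window_left, count_window, hits_add_hits_diff])

/-- The numerator of the statistic of the window `w`. -/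
noncomputable def cmhNumerator (s : Fin n → Obs d) (w : Window) (S : Stratification 𝒵) : ℝ :=
  totalDev (fun t => slab w (S.cell t)) (leftX w) (leftY w) s

theorem count_sub_cmhMean (s : Fin n → Obs d) (w : Window) (C : Set (EuclideanSpace ℝ (Fin d))) :
    (count s w.ILeft w.JLeft C : ℝ) - cmhMean s w C = tableDev (slab w C) (leftX w) (leftY w) s := by
  rw [cmhMean, tableDev, count_left_left, count_left_window, count_window_left, count_window]

theorem cmhStat_eq (s : Fin n → Obs d) (w : Window) (S : Stratification 𝒵) :
    cmhStat s w S = cmhNumerator s w S / √(∑ t, cmhVar s w (S.cell t)) := by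
  simp only [cmhStat, count_sub_cmhMean, cmhNumerator, totalDev]

/-- A table deviates from its null mean by at most each of its margins. -/
theorem tableDev_le_margins (s : Fin n → Obs d) (w : Window)
    (C : Set (EuclideanSpace ℝ (Fin d))) :
    tableDev (slab w C) (leftX w) (leftY w) s ≤ count s w.ILeft w.J C ∧
    tableDev (slab w C) (leftX w) (leftY w) s ≤ count s w.IRight w.J C ∧
    tableDev (slab w C) (leftX w) (leftY w) s ≤ count s w.I w.JLeft C ∧
    tableDev (slab w C) (leftX w) (leftY w) s ≤ count s w.I w.JRight C := by
  have h1 : (count s w.ILeft w.JLeft C : ℝ) ≤ count s w.ILeft w.J C := by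
    rw [count_left_left, count_left_window]
    exact hits_mono (Set.inter_subset_inter_right _ Set.inter_subset_left) s
  have h2 : (count s w.ILeft w.JLeft C : ℝ) ≤ count s w.I w.JLeft C := by
    rw [count_left_left, count_window_left]
    exact hits_mono (Set.inter_subset_inter_right _ Set.inter_subset_right) s
  have h3 : (count s w.ILeft w.J C + count s w.IRight w.J C : ℝ) = count s w.I w.J C := by
    exact_mod_cast count_left_add_right s w C
  have h4 : (count s w.I w.JLeft C + count s w.I w.JRight C : ℝ) = count s w.I w.J C := by
    exact_mod_cast count_add_left_right s w C
  rw [← count_sub_cmhMean, cmhMean]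
  have a0 : (0 : ℝ) ≤ count s w.ILeft w.J C := Nat.cast_nonneg _
  have a1 : (0 : ℝ) ≤ count s w.IRight w.J C := Nat.cast_nonneg _
  have b0 : (0 : ℝ) ≤ count s w.I w.JLeft C := Nat.cast_nonneg _
  have b1 : (0 : ℝ) ≤ count s w.I w.JRight C := Nat.cast_nonneg _
  generalize (count s w.ILeft w.JLeft C : ℝ) = k at *
  generalize (count s w.ILeft w.J C : ℝ) = a at *
  generalize (count s w.IRight w.J C : ℝ) = a' at *
  generalize (count s w.I w.JLeft C : ℝ) = b at *
  generalize (count s w.I w.JRight C : ℝ) = b' at *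
  rw [← h3] at h4 ⊢
  have hq : 0 ≤ a * b / (a + a') := by positivity
  rcases (add_nonneg a0 a1).eq_or_lt with h0 | h0
  · rw [← h0] at h4 ⊢
    simp only [div_zero, sub_zero]
    refine ⟨h1, ?_, h2, ?_⟩ <;> linarith
  · refine ⟨by linarith, ?_, by linarith, ?_⟩
    -- The upper left cell is at most `b`, so the deviation is at most `b - a b / N = a' b / N ≤
    -- a'`, where `N = a + a'`.
    · have e : b - a * b / (a + a') = a' * (b / (a + a')) := by field_simp; ring
      have := mul_le_of_le_one_right a1 ((div_le_one h0).2 (by linarith : b ≤ a + a'))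
      linarith
    · have e : a - a * b / (a + a') = b' * (a / (a + a')) := by
        rw [show b' = a + a' - b by linarith]; field_simp
      have := mul_le_of_le_one_right b1 ((div_le_one h0).2 (by linarith : a ≤ a + a'))
      linarith

theorem sum_count_le (s : Fin n → Obs d) (S : Stratification 𝒵) (A B : Set ℝ) :
    ∑ t, (count s A B (S.cell t) : ℝ) ≤ count s A B Set.univ := by
  simp only [count_eq_hits, hits]
  rw [Finset.sum_comm]
  refine Finset.sum_le_sum fun i _ => ?_
  have hd : Pairwise fun t t' => Disjoint (A ×ˢ B ×ˢ S.cell t) (A ×ˢ B ×ˢ S.cell t') :=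
    fun _ _ h => Set.disjoint_left.2 fun _ ho ho' =>
      Set.disjoint_left.1 (S.disjoint_cell h) ho.2.2 ho'.2.2
  by_cases h : s i ∈ A ×ˢ B ×ˢ (Set.univ : Set (EuclideanSpace ℝ (Fin d)))
  · rw [Set.indicator_of_mem h]
    exact sum_indicator_le_one hd _
  · rw [Set.indicator_of_notMem h]
    refine (Finset.sum_eq_zero fun t _ => Set.indicator_of_notMem (fun h' => h ?_) _).le
    exact ⟨h'.1, h'.2.1, trivial⟩

theorem cmhNumerator_le_margins (s : Fin n → Obs d) (w : Window) (S : Stratification 𝒵) :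
    cmhNumerator s w S ≤ count s w.ILeft w.J Set.univ ∧
    cmhNumerator s w S ≤ count s w.IRight w.J Set.univ ∧
    cmhNumerator s w S ≤ count s w.I w.JLeft Set.univ ∧
    cmhNumerator s w S ≤ count s w.I w.JRight Set.univ := by
  have h := fun t => tableDev_le_margins s w (S.cell t)
  exact ⟨(Finset.sum_le_sum fun t _ => (h t).1).trans (sum_count_le s S _ _),
    (Finset.sum_le_sum fun t _ => (h t).2.1).trans (sum_count_le s S _ _),
    (Finset.sum_le_sum fun t _ => (h t).2.2.1).trans (sum_count_le s S _ _),
    (Finset.sum_le_sum fun t _ => (h t).2.2.2).trans (sum_count_le s S _ _)⟩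

/-- A deviation cannot exceed any margin, so a large numerator makes the window valid without a
separate estimate of its counts. -/
theorem screened_of_le_cmhNumerator {vAll vMargin : ℕ} {s : Fin n → Obs d} {w : Window}
    {S : Stratification 𝒵} (h1 : (vAll : ℝ) ≤ cmhNumerator s w S)
    (h2 : (vMargin : ℝ) ≤ cmhNumerator s w S) : Screened vAll vMargin s w := by
  obtain ⟨a, b, c, e⟩ := cmhNumerator_le_margins s w S
  have h3 : vAll ≤ count s w.ILeft w.J Set.univ := by exact_mod_cast h1.trans a
  refine ⟨?_, by exact_mod_cast h2.trans a, by exact_mod_cast h2.trans b,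
    by exact_mod_cast h2.trans c, by exact_mod_cast h2.trans e⟩
  have := count_left_add_right s w Set.univ
  omega

theorem natCast_sq_mul_sub_one_nonneg (N : ℕ) : (0 : ℝ) ≤ (N : ℝ) ^ 2 * ((N : ℝ) - 1) := by
  rcases Nat.eq_zero_or_pos N with rfl | h
  · simp
  · have : (1 : ℝ) ≤ N := by exact_mod_cast h
    exact mul_nonneg (sq_nonneg _) (by linarith)

theorem cmhVar_nonneg (s : Fin n → Obs d) (w : Window) (C : Set (EuclideanSpace ℝ (Fin d))) :
    0 ≤ cmhVar s w C :=
  div_nonneg (by positivity) (natCast_sq_mul_sub_one_nonneg _)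

/-- Each product of complementary margins is at most `N² / 4`, so the variance is at most `N² / (16
(N - 1)) ≤ N` when `N ≥ 2`. Summed over strata this gives a denominator of order at most `√n`. -/
theorem cmhVar_le (s : Fin n → Obs d) (w : Window) (C : Set (EuclideanSpace ℝ (Fin d))) :
    cmhVar s w C ≤ count s w.I w.J C := by
  have h3 : (count s w.ILeft w.J C + count s w.IRight w.J C : ℝ) = count s w.I w.J C := by
    exact_mod_cast count_left_add_right s w C
  have h4 : (count s w.I w.JLeft C + count s w.I w.JRight C : ℝ) = count s w.I w.J C := by
    exact_mod_cast count_add_left_right s w C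
  rw [cmhVar]
  generalize (count s w.ILeft w.J C : ℝ) = a at *
  generalize (count s w.IRight w.J C : ℝ) = a' at *
  generalize hb : (count s w.I w.JLeft C : ℝ) = b at *
  generalize hb' : (count s w.I w.JRight C : ℝ) = b' at *
  generalize count s w.I w.J C = N at *
  rcases Nat.lt_or_ge N 2 with hN | hN
  -- For `N = 0` and `N = 1` the denominator `N² (N - 1)` vanishes and the quotient is 0 by
  -- convention.
  · interval_cases N <;> simp
  · have hN2 : (2 : ℝ) ≤ N := by exact_mod_cast hN
    have ha : a * a' ≤ (N : ℝ) ^ 2 / 4 := by rw [← h3]; nlinarith [sq_nonneg (a - a')]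
    have hb : b * b' ≤ (N : ℝ) ^ 2 / 4 := by rw [← h4]; nlinarith [sq_nonneg (b - b')]
    have hb0 : 0 ≤ b * b' := by
      rw [← ‹(count s w.I w.JLeft C : ℝ) = b›, ← hb']
      positivity
    have hab : (a * a') * (b * b') ≤ (N : ℝ) ^ 2 / 4 * ((N : ℝ) ^ 2 / 4) :=
      mul_le_mul ha hb hb0 (by positivity)
    have h1 : (0 : ℝ) < N - 1 := by linarith
    rw [div_le_iff₀ (by positivity)]
    have h2 : (N : ℝ) ^ 2 / 4 * ((N : ℝ) ^ 2 / 4) ≤ N * ((N : ℝ) ^ 2 * (N - 1)) := by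
      have h5 : (0 : ℝ) ≤ (N : ℝ) ^ 3 := by positivity
      nlinarith [mul_le_mul_of_nonneg_left (by linarith : (N : ℝ) / 16 ≤ N - 1) h5]
    linarith

/-- A positive deviation makes all four margins positive. This excludes a vanishing denominator,
where the statistic would be 0 by convention despite a positive numerator. -/
theorem cmhVar_pos {s : Fin n → Obs d} {w : Window} {C : Set (EuclideanSpace ℝ (Fin d))}
    (h : 0 < tableDev (slab w C) (leftX w) (leftY w) s) : 0 < cmhVar s w C := by
  obtain ⟨h1, h2, h3, h4⟩ := tableDev_le_margins s w C
  have h1 := h.trans_le h1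
  have h2 := h.trans_le h2
  have h3 := h.trans_le h3
  have h4 := h.trans_le h4
  have h5 : (1 : ℝ) < count s w.I w.J C := by
    have := count_left_add_right s w C
    norm_cast at h1 h2 ⊢
    omega
  have h6 : (0 : ℝ) < count s w.I w.J C - 1 := by linarith
  rw [cmhVar]
  positivity

theorem sum_cmhVar_le (s : Fin n → Obs d) (w : Window) (S : Stratification 𝒵) :
    ∑ t, cmhVar s w (S.cell t) ≤ n := by
  refine (Finset.sum_le_sum fun t _ => cmhVar_le s w (S.cell t)).trans
    ((sum_count_le s S _ _).trans ?_)
  rw [count_eq_hits]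
  exact hits_le _ _

theorem div_le_cmhStat_sq {s : Fin n → Obs d} {w : Window} {S : Stratification 𝒵}
    (h : 0 < cmhNumerator s w S) : cmhNumerator s w S ^ 2 / n ≤ cmhStat s w S ^ 2 := by
  have hV : 0 < ∑ t, cmhVar s w (S.cell t) := by
    obtain ⟨t, -, ht⟩ := Finset.exists_lt_of_sum_lt (f := fun _ : Fin S.T => (0 : ℝ))
      (g := fun t => tableDev (slab w (S.cell t)) (leftX w) (leftY w) s) (s := Finset.univ)
      (by rw [Finset.sum_const_zero]; exact h)
    exact Finset.sum_pos' (fun _ _ => cmhVar_nonneg _ _ _) ⟨t, Finset.mem_univ _, cmhVar_pos ht⟩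
  rw [cmhStat_eq, div_pow, Real.sq_sqrt hV.le]
  exact div_le_div_of_nonneg_left (sq_nonneg _) hV (sum_cmhVar_le s w S)

end Deterministic

/-! ### Tail of the chi-squared distribution -/

instance : IsProbabilityMeasure chiSqOne :=
  Measure.isProbabilityMeasure_map (measurable_id.pow_const 2).aemeasurable

theorem integral_sq_gaussianReal : ∫ x, x ^ 2 ∂(gaussianReal 0 1) = 1 := by
  have h := variance_id_gaussianReal (μ := 0) (v := 1)
  rw [variance_eq_integral measurable_id.aemeasurable] at h
  simpa [integral_id_gaussianReal] using h

theorem integrable_sq_gaussianReal : Integrable (fun x : ℝ => x ^ 2) (gaussianReal 0 1) :=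
  (memLp_id_gaussianReal 2).integrable_sq

/-- Markov's inequality for the square of a standard normal variable, whose mean is 1. This
polynomial tail suffices because the corrected level decays at most logarithmically. -/
theorem one_sub_cdf_chiSqOne_le {x : ℝ} (hx : 0 < x) : 1 - cdf chiSqOne x ≤ 1 / x := by
  rw [cdf_eq_real, ← probReal_compl_eq_one_sub measurableSet_Iic, chiSqOne,
    map_measureReal_apply (by fun_prop) measurableSet_Iic.compl, le_div_iff₀ hx,
    mul_comm, ← integral_sq_gaussianReal]
  refine le_trans ?_ (mul_meas_ge_le_integral_of_nonneg (ae_of_all _ fun y => sq_nonneg y)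
    integrable_sq_gaussianReal x)
  refine mul_le_mul_of_nonneg_left (measureReal_mono fun y hy => ?_) hx.le
  simp only [Set.mem_preimage, Set.mem_compl_iff, Set.mem_Iic, not_le] at hy
  exact hy.le

/-! ### Significance -/

section Significance
variable {d n : ℕ} {𝒵 : Set (EuclideanSpace ℝ (Fin d))}

theorem pValue_le {s : Fin n → Obs d} {w : Window} {S : Stratification 𝒵}
    (hn : 0 < n) (h : 0 < cmhNumerator s w S) : pValue s w S ≤ n / cmhNumerator s w S ^ 2 := by
  have hn' : (0 : ℝ) < n := by exact_mod_cast hn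
  have h1 := div_le_cmhStat_sq h
  have h2 : 0 < cmhNumerator s w S ^ 2 / n := by positivity
  calc pValue s w S ≤ 1 / cmhStat s w S ^ 2 := one_sub_cdf_chiSqOne_le (h2.trans_le h1)
    _ ≤ 1 / (cmhNumerator s w S ^ 2 / n) := one_div_le_one_div_of_le h2 h1
    _ = _ := one_div_div _ _

theorem numWindows_le (vAll vMargin : ℕ) (s : Fin n → Obs d) (l₁ l₂ : ℕ) :
    numWindows vAll vMargin s l₁ l₂ ≤ 2 ^ l₁ * 2 ^ l₂ := by
  simpa [numWindows] using Finset.card_le_univ (validWindows vAll vMargin s l₁ l₂)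

theorem numPartitions_le (vAll vMargin k₁ k₂ : ℕ) (s : Fin n → Obs d) (k : ℕ) :
    numPartitions vAll vMargin k₁ k₂ s k ≤ k + 1 := by
  rw [← Finset.Nat.card_antidiagonal]
  refine Finset.card_le_card fun l hl => ?_
  simp only [validPartitions, Finset.mem_filter] at hl
  exact Finset.HasAntidiagonal.mem_antidiagonal.2 hl.2.1

theorem mem_validWindows {vAll vMargin : ℕ} {s : Fin n → Obs d} {w : Window}
    (h : Screened vAll vMargin s w) : (w.i, w.j) ∈ validWindows vAll vMargin s w.l₁ w.l₂ := by
  simpa [validWindows] using h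

theorem numWindows_pos {vAll vMargin : ℕ} {s : Fin n → Obs d} {w : Window}
    (h : Screened vAll vMargin s w) : 0 < numWindows vAll vMargin s w.l₁ w.l₂ :=
  Finset.card_pos.2 ⟨_, mem_validWindows h⟩

theorem mem_validPartitions {vAll vMargin k₁ k₂ : ℕ} {s : Fin n → Obs d} {w : Window}
    (h : Screened vAll vMargin s w) (h₁ : w.l₁ < k₁) (h₂ : w.l₂ < k₂) :
    (w.l₁, w.l₂) ∈ validPartitions vAll vMargin k₁ k₂ s (w.l₁ + w.l₂) := by
  simpa [validPartitions, h₁, h₂] using numWindows_pos h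

theorem numPartitions_pos {vAll vMargin k₁ k₂ : ℕ} {s : Fin n → Obs d} {w : Window}
    (h : Screened vAll vMargin s w) (h₁ : w.l₁ < k₁) (h₂ : w.l₂ < k₂) :
    0 < numPartitions vAll vMargin k₁ k₂ s (w.l₁ + w.l₂) :=
  Finset.card_pos.2 ⟨_, mem_validPartitions h h₁ h₂⟩

/-- Bernoulli's inequality: the Šidák level dominates the Bonferroni level. -/
theorem div_le_one_sub_rpow {α N : ℝ} (hα₁ : α < 1) (hN : 1 ≤ N) :
    α / N ≤ 1 - (1 - α) ^ ((1 : ℝ) / N) := by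
  have h := rpow_one_add_le_one_add_mul_self (s := -α) (by linarith) (p := 1 / N)
    (by positivity) ((div_le_one (by linarith)).2 hN)
  rw [← sub_eq_add_neg] at h
  have e : 1 / N * -α = -(α / N) := by ring
  linarith

/-- A lower bound of the corrected level: the multiplicity of the window is at most a constant
multiple of `k₁ + k₂`. -/
theorem div_le_windowLevel {vAll vMargin k₁ k₂ : ℕ} {α : ℝ} (hα₀ : 0 < α) (hα₁ : α < 1)
    {s : Fin n → Obs d} {w : Window} (h : Screened vAll vMargin s w) (h₁ : w.l₁ < k₁)
    (h₂ : w.l₂ < k₂) :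
    α / ((k₁ + k₂) * ((w.l₁ + w.l₂ + 1) * (2 ^ w.l₁ * 2 ^ w.l₂))) ≤
      windowLevel vAll vMargin k₁ k₂ α s w := by
  have hU : (1 : ℝ) ≤ numPartitions vAll vMargin k₁ k₂ s (w.l₁ + w.l₂) := by
    exact_mod_cast numPartitions_pos h h₁ h₂
  have hL : (1 : ℝ) ≤ numWindows vAll vMargin s w.l₁ w.l₂ := by exact_mod_cast numWindows_pos h
  have hU' : (numPartitions vAll vMargin k₁ k₂ s (w.l₁ + w.l₂) : ℝ) ≤ w.l₁ + w.l₂ + 1 := by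
    exact_mod_cast numPartitions_le vAll vMargin k₁ k₂ s (w.l₁ + w.l₂)
  have hL' : (numWindows vAll vMargin s w.l₁ w.l₂ : ℝ) ≤ 2 ^ w.l₁ * 2 ^ w.l₂ := by
    exact_mod_cast numWindows_le vAll vMargin s w.l₁ w.l₂
  have hk₁ : (1 : ℝ) ≤ k₁ := by exact_mod_cast (Nat.zero_le _).trans_lt h₁
  have hk₂ : (1 : ℝ) ≤ k₂ := by exact_mod_cast (Nat.zero_le _).trans_lt h₂
  have hK : (1 : ℝ) ≤ k₁ + k₂ - 1 := by linarith
  have hN : (1 : ℝ) ≤ (k₁ + k₂ - 1) * numPartitions vAll vMargin k₁ k₂ s (w.l₁ + w.l₂) *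
      numWindows vAll vMargin s w.l₁ w.l₂ :=
    one_le_mul_of_one_le_of_one_le (one_le_mul_of_one_le_of_one_le hK hU) hL
  refine le_trans ?_ (div_le_one_sub_rpow hα₁ hN)
  refine div_le_div_of_nonneg_left hα₀.le (by linarith) ?_
  rw [mul_assoc]
  gcongr
  linarith

/-- Deterministic criterion into which the concentration bound is fed: the last hypothesis compares
the p-value bound `n / a²` with the Bonferroni-type lower bound of the level. -/
theorem significant_of_le_cmhNumerator {vAll vMargin k₁ k₂ : ℕ} {α : ℝ} (hα₀ : 0 < α)
    (hα₁ : α < 1) {s : Fin n → Obs d} {w : Window} {S : Stratification 𝒵} (hn : 0 < n) {a : ℝ}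
    (ha : 0 < a) (has : a ≤ cmhNumerator s w S) (hAll : vAll ≤ a) (hMargin : vMargin ≤ a)
    (h₁ : w.l₁ < k₁) (h₂ : w.l₂ < k₂)
    (h : n * ((k₁ + k₂) * ((w.l₁ + w.l₂ + 1) * (2 ^ w.l₁ * 2 ^ w.l₂))) ≤ α * a ^ 2) :
    Significant vAll vMargin k₁ k₂ α s w S := by
  have hs : Screened vAll vMargin s w :=
    screened_of_le_cmhNumerator (hAll.trans has) (hMargin.trans has)
  refine ⟨hs, (pValue_le hn (ha.trans_le has)).trans
    (le_trans ?_ (div_le_windowLevel hα₀ hα₁ hs h₁ h₂))⟩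
  have hk₁ : (1 : ℝ) ≤ k₁ := by exact_mod_cast (Nat.zero_le _).trans_lt h₁
  have hpos := ha.trans_le has
  rw [div_le_div_iff₀ (by positivity) (by positivity)]
  exact h.trans (mul_le_mul_of_nonneg_left (pow_le_pow_left₀ ha.le has 2) hα₀.le)

theorem minP_le {ι : Type} {F : Finset ι} (p : ι → ℝ) {a : ι} (ha : a ∈ F) : minP F p ≤ p a := by
  rw [minP, dif_pos ⟨a, ha⟩]
  exact Finset.inf'_le p ha

/-- One stage of the Šidák correction. -/
theorem rpow_le_one_sub_minP_pow {ι : Type} {F : Finset ι} {p : ι → ℝ} {a : ι} (ha : a ∈ F)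
    {β y : ℝ} (hβ : 0 ≤ β) {m : ℕ} (hm : 0 < m) (h : β ^ (y / m) ≤ 1 - p a) :
    β ^ y ≤ (1 - minP F p) ^ m := by
  calc β ^ y = (β ^ (y / m)) ^ m := by
        rw [← Real.rpow_mul_natCast hβ, div_mul_cancel₀ _ (by exact_mod_cast hm.ne')]
    _ ≤ (1 - minP F p) ^ m := pow_le_pow_left₀ (Real.rpow_nonneg hβ _)
        (h.trans (sub_le_sub_left (minP_le p ha) 1)) m

/-- Each stage's power removes one factor from the exponent of `1 - α`: first `L`, then `U`, then
`k₁ + k₂ - 1`. Minima only decrease when other windows are included, so their stratifications are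
irrelevant. -/
theorem pOverall_le_of_significant {vAll vMargin k₁ k₂ : ℕ} {α : ℝ} (hα₁ : α < 1)
    {s : Fin n → Obs d} {w : Window} {strat : Window → Stratification 𝒵}
    (h₁ : w.l₁ < k₁) (h₂ : w.l₂ < k₂)
    (h : Significant vAll vMargin k₁ k₂ α s w (strat w)) :
    pOverall vAll vMargin k₁ k₂ strat s ≤ α := by
  obtain ⟨hs, hp⟩ := h
  have hβ : 0 ≤ 1 - α := by linarith
  have hU := numPartitions_pos hs h₁ h₂
  have hK : ((k₁ + k₂ - 1 : ℕ) : ℝ) = (k₁ : ℝ) + k₂ - 1 := by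
    rw [Nat.cast_sub (by omega)]; push_cast; ring
  have hstage₁ : (1 - α) ^ ((1 : ℝ) / ((k₁ + k₂ - 1 : ℕ) : ℝ) /
      (numPartitions vAll vMargin k₁ k₂ s (w.l₁ + w.l₂) : ℝ)) ≤
      1 - pPartition vAll vMargin strat s w.l₁ w.l₂ := by
    rw [pPartition, sub_sub_cancel]
    refine rpow_le_one_sub_minP_pow (mem_validWindows hs) hβ (numWindows_pos hs) ?_
    rw [div_div, div_div, hK, ← mul_assoc]
    rw [windowLevel] at hp
    change _ ≤ 1 - pValue s w (strat w)
    linarith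
  have hstage₂ : (1 - α) ^ ((1 : ℝ) / ((k₁ + k₂ - 1 : ℕ) : ℝ)) ≤
      1 - pResolution vAll vMargin k₁ k₂ strat s (w.l₁ + w.l₂) := by
    rw [pResolution, sub_sub_cancel]
    exact rpow_le_one_sub_minP_pow (mem_validPartitions hs h₁ h₂) hβ hU hstage₁
  have hmem : w.l₁ + w.l₂ ∈ (Finset.range (k₁ + k₂ - 1)).filter fun k =>
      0 < numPartitions vAll vMargin k₁ k₂ s k :=
    Finset.mem_filter.2 ⟨Finset.mem_range.2 (by omega), hU⟩
  have hstage₃ := rpow_le_one_sub_minP_pow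
    (p := fun k => pResolution vAll vMargin k₁ k₂ strat s k) hmem hβ
    (show 0 < k₁ + k₂ - 1 by omega) hstage₂
  rw [Real.rpow_one] at hstage₃
  rw [pOverall]
  linarith

/-! ### Measurability -/

theorem measurable_count {A B : Set ℝ} {C : Set (EuclideanSpace ℝ (Fin d))}
    (hA : MeasurableSet A) (hB : MeasurableSet B) (hC : MeasurableSet C) :
    Measurable fun s : Fin n → Obs d => count s A B C := by
  classical
  simp only [count, Finset.card_filter]
  refine Finset.measurable_sum _ fun i _ => Measurable.ite ?_ measurable_const measurable_const
  exact (measurable_pi_apply i : Measurable fun s : Fin n → Obs d => s i) (hA.prod (hB.prod hC))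

theorem measurable_margins (k₁ k₂ : ℕ) (S : Stratification 𝒵) :
    Measurable (margins (n := n) k₁ k₂ S) :=
  (measurable_pi_lambda _ fun _ => measurable_pi_lambda _ fun t =>
    measurable_count (measurableSet_node _ _) (measurableSet_node _ _) (S.measurable_cell t)).prodMk
  (measurable_pi_lambda _ fun _ => measurable_pi_lambda _ fun t =>
    measurable_count (measurableSet_node _ _) (measurableSet_node _ _) (S.measurable_cell t))

theorem measurableSet_screened (vAll vMargin : ℕ) (w : Window) :
    MeasurableSet {s : Fin n → Obs d | Screened vAll vMargin s w} := by
  have h : ∀ (l l' i i' v : ℕ), MeasurableSet {s : Fin n → Obs d |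
      v ≤ count s (node l i) (node l' i') Set.univ} := fun l l' i i' v =>
    measurableSet_le measurable_const
      (measurable_count (measurableSet_node _ _) (measurableSet_node _ _) MeasurableSet.univ)
  exact (h _ _ _ _ _).inter ((h _ _ _ _ _).inter ((h _ _ _ _ _).inter
    ((h _ _ _ _ _).inter (h _ _ _ _ _))))

theorem measurable_numWindows (vAll vMargin l₁ l₂ : ℕ) :
    Measurable fun s : Fin n → Obs d => numWindows vAll vMargin s l₁ l₂ := by
  classical
  simp only [numWindows, validWindows, Finset.card_filter]
  exact Finset.measurable_sum _ fun i _ =>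
    Measurable.ite (measurableSet_screened _ _ _) measurable_const measurable_const

theorem measurable_numPartitions (vAll vMargin k₁ k₂ k : ℕ) :
    Measurable fun s : Fin n → Obs d => numPartitions vAll vMargin k₁ k₂ s k := by
  simp only [numPartitions, validPartitions, Finset.card_filter]
  exact Finset.measurable_sum _ fun l _ => Measurable.ite ((MeasurableSet.const _).inter
    (measurableSet_lt measurable_const (measurable_numWindows _ _ _ _)))
    measurable_const measurable_const

theorem measurable_cmhStat (w : Window) (S : Stratification 𝒵) :
    Measurable fun s : Fin n → Obs d => cmhStat s w S := by
  have h : ∀ (l l' i i' : ℕ) (t), Measurable fun s : Fin n → Obs d =>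
      (count s (node l i) (node l' i') (S.cell t) : ℝ) := fun l l' i i' t =>
    measurable_from_top.comp (measurable_count (measurableSet_node _ _) (measurableSet_node _ _)
      (S.measurable_cell t))
  refine Measurable.div (Finset.measurable_sum _ fun t _ => (h _ _ _ _ t).sub
    (((h _ _ _ _ t).mul (h _ _ _ _ t)).div (h _ _ _ _ t))) (Measurable.sqrt ?_)
  exact Finset.measurable_sum _ fun t _ =>
    ((((h _ _ _ _ t).mul (h _ _ _ _ t)).mul (h _ _ _ _ t)).mul (h _ _ _ _ t)).div
      (((h _ _ _ _ t).pow_const 2).mul ((h _ _ _ _ t).sub_const 1))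

theorem measurableSet_significant (vAll vMargin k₁ k₂ : ℕ) (α : ℝ) (w : Window)
    (S : Stratification 𝒵) :
    MeasurableSet {s : Fin n → Obs d | Significant vAll vMargin k₁ k₂ α s w S} := by
  refine MeasurableSet.inter (s₂ := {s | pValue s w S ≤ windowLevel vAll vMargin k₁ k₂ α s w})
    (measurableSet_screened _ _ _) (measurableSet_le ?_ ?_)
  · exact measurable_const.sub
      ((monotone_cdf _).measurable.comp ((measurable_cmhStat w S).pow_const 2))
  · refine measurable_const.sub (measurable_const.pow (measurable_const.div
      ((measurable_const.mul ?_).mul ?_)))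
    · exact measurable_from_top.comp (measurable_numPartitions _ _ _ _ _)
    · exact measurable_from_top.comp (measurable_numWindows _ _ _ _)

end Significance

/-! ### Conditional probabilities close to one -/

/-- The conditional probability is almost surely at most 1 and has mean `P(A)`, so its mean distance
to 1 is `1 - P(A)`; Markov's inequality concludes, whatever the conditioning σ-algebra. -/
theorem measureReal_abs_condExp_sub_one_le {Ω : Type*} {m m₀ : MeasurableSpace Ω} (hm : m ≤ m₀)
    (P : Measure[m₀] Ω) [IsProbabilityMeasure P] {A : Set Ω} (hA : MeasurableSet[m₀] A) {ε : ℝ}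
    (hε : 0 < ε) : P.real {s | ε ≤ |(P⟦A | m⟧) s - 1|} ≤ (1 - P.real A) / ε := by
  have hi : Integrable (A.indicator fun _ => (1 : ℝ)) P := (integrable_const 1).indicator hA
  have hle : P⟦A | m⟧ ≤ᵐ[P] fun _ => 1 := by
    have := condExp_mono (m := m) hi (integrable_const (1 : ℝ))
      (ae_of_all P fun s => Set.indicator_le_self' (fun _ _ => zero_le_one) s)
    rwa [condExp_const hm] at this
  rw [le_div_iff₀ hε, mul_comm]
  refine (mul_meas_ge_le_integral_of_nonneg (ae_of_all P fun s => abs_nonneg _)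
    (integrable_condExp.sub (integrable_const 1)).abs ε).trans_eq ?_
  calc ∫ s, |(P⟦A | m⟧) s - 1| ∂P = ∫ s, (1 - (P⟦A | m⟧) s) ∂P := by
        refine integral_congr_ae ?_
        filter_upwards [hle] with s hs
        rw [abs_sub_comm, abs_of_nonneg (by linarith)]
    _ = 1 - P.real A := by
        rw [integral_sub (integrable_const _) integrable_condExp, integral_condExp hm,
          integral_indicator_const _ hA]
        simp

end MultiCMH

namespace MultiCMH

/-! ### Asymptotics of significance -/

section Consistency
variable {d : ℕ} {𝒵 : Set (EuclideanSpace ℝ (Fin d))}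

theorem eventually_natCast_mul_le {k₁ k₂ : ℕ → ℕ}
    (hk₁ : (fun n => (k₁ n : ℝ)) =O[atTop] fun n : ℕ => Real.log n)
    (hk₂ : (fun n => (k₂ n : ℝ)) =O[atTop] fun n : ℕ => Real.log n) {b c : ℝ} (hb : 0 < b)
    (hc : 0 < c) : ∀ᶠ n : ℕ in atTop, n * ((k₁ n + k₂ n) * b) ≤ c * (n : ℝ) ^ 2 := by
  have h := (hk₁.add hk₂).trans_isLittleO
    (Real.isLittleO_log_id_atTop.comp_tendsto tendsto_natCast_atTop_atTop)
  filter_upwards [h.bound (c := c / b) (by positivity)] with n hn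
  simp only [Function.comp_apply, id, Real.norm_natCast] at hn
  rw [Real.norm_of_nonneg (by positivity)] at hn
  calc (n * ((k₁ n + k₂ n) * b) : ℝ) ≤ n * ((c / b * n) * b) := by gcongr
    _ = c * (n : ℝ) ^ 2 := by field_simp

/-- With probability tending to one a signal window is significant. -/
theorem tendsto_measureReal_significant (h𝒵 : MeasurableSet 𝒵) (Q : Measure (Obs d))
    [IsProbabilityMeasure Q] {k₁ k₂ : ℕ → ℕ}
    (hk₁ : (fun n => (k₁ n : ℝ)) =O[atTop] fun n : ℕ => Real.log n)
    (hk₂ : (fun n => (k₂ n : ℝ)) =O[atTop] fun n : ℕ => Real.log n)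
    (vAll vMargin : ℕ) {α : ℝ} (hα₀ : 0 < α) (hα₁ : α < 1) {w : Window}
    {S : ℕ → Stratification 𝒵} (hw : ∀ᶠ n in atTop, w.l₁ < k₁ n ∧ w.l₂ < k₂ n)
    (hS : SignalWindow 𝒵 Q w S) :
    Tendsto (fun n : ℕ => (Measure.pi fun _ : Fin n => Q).real
      {s | Significant vAll vMargin (k₁ n) (k₂ n) α s w (S n)}) atTop (𝓝 1) := by
  obtain ⟨c, hc, hmean⟩ := exists_linear_le_integral_totalDev h𝒵 Q w S hS
  have hlim : Tendsto (fun n : ℕ => 1 - 16 / c ^ 2 / (n : ℝ)) atTop (𝓝 1) := by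
    have h₀ : Tendsto (fun n : ℕ => 16 / c ^ 2 / (n : ℝ)) atTop (𝓝 0) :=
      tendsto_const_div_atTop_nhds_zero_nat _
    simpa using h₀.const_sub 1
  refine tendsto_of_tendsto_of_tendsto_of_le_of_le' hlim tendsto_const_nhds ?_
    (Eventually.of_forall fun n => measureReal_le_one)
  -- The mean is at least `c n`; a threshold of `c n / 2` leaves an equal margin for Chebyshev's
  -- inequality, with error `4 n / (c n / 2)² = 16 / (c² n)`.
  have hlin : Tendsto (fun n : ℕ => c / 2 * (n : ℝ)) atTop atTop :=
    tendsto_natCast_atTop_atTop.const_mul_atTop (half_pos hc)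
  filter_upwards [hmean, hw, eventually_gt_atTop 0, hlin.eventually_ge_atTop (vAll : ℝ),
    hlin.eventually_ge_atTop (vMargin : ℝ), eventually_natCast_mul_le hk₁ hk₂
      (b := (w.l₁ + w.l₂ + 1) * (2 ^ w.l₁ * 2 ^ w.l₂)) (c := α * (c / 2) ^ 2)
      (by positivity) (by positivity)] with n hmean ⟨h₁, h₂⟩ hn hAll hMargin hk
  have hn' : (0 : ℝ) < n := by exact_mod_cast hn
  have hr : 0 < c / 2 * n := by positivity
  have hdev := measure_totalDev_lt_le Q (n := n) (U := fun t => slab w ((S n).cell t))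
    (A := leftX w) (B := leftY w) (fun t => measurableSet_slab w ((S n).measurable_cell t))
    (measurableSet_leftX w) (measurableSet_leftY w) (pairwise_disjoint_slab w (S n)) hr
    (c / 2 * n) (by linarith)
  have hcompl : 1 - (Measure.pi fun _ : Fin n => Q).real
      {s | Significant vAll vMargin (k₁ n) (k₂ n) α s w (S n)} ≤ 4 * n / (c / 2 * n) ^ 2 := by
    rw [← probReal_compl_eq_one_sub (measurableSet_significant _ _ _ _ _ _ _)]
    refine (measureReal_mono fun s hs => ?_).trans hdev
    by_contra hlt
    exact hs (significant_of_le_cmhNumerator hα₀ hα₁ hn hr (not_lt.1 hlt) hAll hMargin h₁ h₂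
      (hk.trans_eq (by ring)))
  have e : 4 * n / (c / 2 * n) ^ 2 = 16 / c ^ 2 / (n : ℝ) := by field_simp; ring
  linarith

theorem tendsto_measure_of_tendsto_measureReal {Ω : ℕ → Type*} [∀ n, MeasurableSpace (Ω n)]
    {P : ∀ n, Measure (Ω n)} [∀ n, IsFiniteMeasure (P n)] {A : ∀ n, Set (Ω n)} {a : ℝ}
    (h : Tendsto (fun n => (P n).real (A n)) atTop (𝓝 a)) :
    Tendsto (fun n => P n (A n)) atTop (𝓝 (ENNReal.ofReal a)) := by
  simpa using ENNReal.tendsto_ofReal h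

end Consistency

end MultiCMH

/-- Local and global consistency of the multiscale Cochran–Mantel–Haenszel scan. The depths
`k₁ n`, `k₂ n` are `O(log n)`, which includes fixed depths. `Measure.pi fun _ : Fin n => Q` is the
law of `n` iid observations. In the global claim `strat n w s` is the stratification used in
window `w` for the sample `s`. -/
theorem mainTheorem8 {d : ℕ} (𝒵 : Set (EuclideanSpace ℝ (Fin d))) (h𝒵 : MeasurableSet 𝒵)
    (Q : Measure (MultiCMH.Obs d)) [IsProbabilityMeasure Q]
    (hQ : Q (Set.Ioc (0 : ℝ) 1 ×ˢ Set.Ioc (0 : ℝ) 1 ×ˢ 𝒵) = 1)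
    (k₁ k₂ : ℕ → ℕ)
    (hk₁ : (fun n => (k₁ n : ℝ)) =O[atTop] fun n : ℕ => Real.log n)
    (hk₂ : (fun n => (k₂ n : ℝ)) =O[atTop] fun n : ℕ => Real.log n)
    (vAll vMargin : ℕ) (α : ℝ) (hα₀ : 0 < α) (hα₁ : α < 1) :
    -- local consistency, given the stratum-specific margins and unconditionally
    (∀ (w : MultiCMH.Window) (S : ℕ → MultiCMH.Stratification 𝒵),
      (∀ᶠ n in atTop, w.l₁ < k₁ n ∧ w.l₂ < k₂ n) →
      MultiCMH.SignalWindow 𝒵 Q w S →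
        (∀ ε : ℝ, 0 < ε → Tendsto (fun n : ℕ =>
          (Measure.pi fun _ : Fin n => Q) {s | ε ≤ |((Measure.pi fun _ : Fin n => Q)⟦
            {s' | MultiCMH.Significant vAll vMargin (k₁ n) (k₂ n) α s' w (S n)} |
            MeasurableSpace.comap (MultiCMH.margins (k₁ n) (k₂ n) (S n)) inferInstance⟧) s - 1|})
          atTop (𝓝 0)) ∧
        Tendsto (fun n : ℕ => (Measure.pi fun _ : Fin n => Q)
          {s | MultiCMH.Significant vAll vMargin (k₁ n) (k₂ n) α s w (S n)}) atTop (𝓝 1)) ∧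
    -- global consistency
    (∀ strat : (n : ℕ) → MultiCMH.Window → (Fin n → MultiCMH.Obs d) → MultiCMH.Stratification 𝒵,
      (∃ (w : MultiCMH.Window) (S : ℕ → MultiCMH.Stratification 𝒵),
        (∀ᶠ n in atTop, w.l₁ < k₁ n ∧ w.l₂ < k₂ n) ∧
        MultiCMH.SignalWindow 𝒵 Q w S ∧ ∀ n s, strat n w s = S n) →
      Tendsto (fun n : ℕ => (Measure.pi fun _ : Fin n => Q)
        {s | MultiCMH.pOverall vAll vMargin (k₁ n) (k₂ n) (fun w => strat n w s) s ≤ α})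
        atTop (𝓝 1)) := by
  have key := fun (w : MultiCMH.Window) (S : ℕ → MultiCMH.Stratification 𝒵)
      (hw : ∀ᶠ n in atTop, w.l₁ < k₁ n ∧ w.l₂ < k₂ n) (hS : MultiCMH.SignalWindow 𝒵 Q w S) =>
    MultiCMH.tendsto_measureReal_significant h𝒵 Q hk₁ hk₂ vAll vMargin hα₀ hα₁ hw hS
  refine ⟨fun w S hw hS => ⟨fun ε hε => ?_, ?_⟩, ?_⟩
  · rw [← ENNReal.ofReal_zero]
    refine MultiCMH.tendsto_measure_of_tendsto_measureReal ?_
    have hlim := ((key w S hw hS).const_sub 1).div_const ε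
    rw [sub_self, zero_div] at hlim
    exact squeeze_zero (fun _ => measureReal_nonneg) (fun n =>
      MultiCMH.measureReal_abs_condExp_sub_one_le
        (MultiCMH.measurable_margins (k₁ n) (k₂ n) (S n)).comap_le _
        (MultiCMH.measurableSet_significant _ _ _ _ _ _ _) hε) hlim
  · rw [← ENNReal.ofReal_one]
    exact MultiCMH.tendsto_measure_of_tendsto_measureReal (key w S hw hS)
  · rintro strat ⟨w, S, hw, hS, hstrat⟩
    rw [← ENNReal.ofReal_one]
    refine MultiCMH.tendsto_measure_of_tendsto_measureReal ?_
    refine tendsto_of_tendsto_of_tendsto_of_le_of_le' (key w S hw hS) tendsto_const_nhds ?_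
      (Eventually.of_forall fun n => measureReal_le_one)
    filter_upwards [hw] with n hn
    -- Only monotonicity of the measure is used: with sample-dependent stratifications the rejection
    -- event need not be measurable.
    refine measureReal_mono fun s hs => ?_
    exact MultiCMH.pOverall_le_of_significant (strat := fun w => strat n w s) hα₁ hn.1 hn.2
      (by rw [hstrat]; exact hs)
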